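/- **Setting.** Let $N\ge 1$, $p>1$, $\gamma>0$, and let $E\subset\mathbb{R}^N\times\mathbb{R}$ be open. Let $K_\rho(y)\subset\mathbb{R}^N$ be the (open) cube of edge $2\rho$ centered at $y$, and $(y,s)+Q_{\rho,\tau}=K_\rho(y)\times(s-\tau,s]$. Write $(u-k)_-=\max\{k-u,0\}$, let $D$ denote the weak gradient in the space variables, and let $S\Subset E$ mean that the closure of $S$ is compact and contained in $E$. A measurable function $u:E\to\mathbb{R}$ belongs to $\mathfrak{A}_p^-(E,\gamma)$ if for every cylinder $(y,s)+Q_{R,T}\Subset E$ ($R,T>0$) $$u\in L^\infty\big(s-T,s;L^p(K_R(y))\big)\cap L^p\big(s-T,s;W^{1,p}(K_R(y))\big),$$ and for all $0<\rho<R$, $0<\tau<T$, $k\in\mathbb{R}$ $$\operatorname*{ess\,sup}_{s-\tau<t<s}\int_{K_\rho(y)}(u-k)_-^p(\cdot,t)\,dx+\iint_{(y,s)+Q_{\rho,\tau}}|D(u-k)_-|^p\,dx\,dt\le\Big[\frac{\gamma}{(R-\rho)^p}+\frac{\gamma}{T-\tau}\Big]\iint_{(y,s)+Q_{R,T}}(u-k)_-^p\,dx\,dt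 .$$ It belongs to $\mathfrak{B}_p^-(E,\gamma)$ if $u\in\mathfrak{A}_p^-(E,\gamma)$ and, for every cylinder $(y,s)+Q_{R,T}\Subset E$, $u\in C([s-T,s];L^p(K_R(y)))$ and, for all $0<\rho<R$, $k\in\mathbb{R}$, $$\operatorname*{ess\,sup}_{s-T<t<s}\int_{K_\rho(y)}(u-k)_-^p(\cdot,t)\,dx\le\int_{K_R(y)}(u-k)_-^p(\cdot,s-T)\,dx+\frac{\gamma}{(R-\rho)^p}\iint_{(y,s)+Q_{R,T}}(u-k)_-^p\,dx\,dt .$$ For each time $t$, $[u(\cdot,t)>c]$ denotes $\{x:(x,t)\in E,\ u(x,t)>c\}$. **Proposition 4.2.** For all $N\ge1$, $p>1$, $\gamma>0$, $\alpha\in(0,1)$ and $A>0$ there is $\epsilon>0$, depending only on $N,p,\gamma,\alpha,A$, such that the following holds for every open $E\subset\mathbb{R}^N\times\mathbb{R}$ and every $u\in\mathfrak{B}_p^-(E,\gamma)$ that is non-negative (a.e. in $E$). Whenever $y\in\mathbb{R}^N$, $s\in\mathbb{R}$, $\rho>0$, $M>0$ satisfy $K_\rho(y)\times(s,s+A\rho^p]\subset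 E$ and $$|[u(\cdot,s)>M]\cap K_\rho(y)|\ge\alpha|K_\rho|,$$ then $$|[u(\cdot,t)>\epsilon M]\cap K_\rho(y)|\ge\frac{\alpha}{2}|K_\rho|\qquad\text{for all } s<t<s+A\rho^p .$$ -/

import Mathlib

open MeasureTheory Set Filter Topology
open scoped ENNReal

namespace ParabolicDeGiorgi

/-- Euclidean space `ℝ^N` (with the Euclidean norm and Lebesgue measure). -/
abbrev Space (N : ℕ) := EuclideanSpace ℝ (Fin N)

/-- Space-time `ℝ^N × ℝ`; the last component is time. -/
abbrev SpaceTime (N : ℕ) := Space N × ℝ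

/-- `K_ρ(y)`: the (open) cube of edge `2ρ` centered at `y`. -/
def cube {N : ℕ} (y : Space N) (ρ : ℝ) : Set (Space N) :=
  {x | ∀ i, |x i - y i| < ρ}

/-- The cylinder `(y,s) + Q_{ρ,τ} = K_ρ(y) × (s - τ, s]`. -/
def cyl {N : ℕ} (y : Space N) (s ρ τ : ℝ) : Set (SpaceTime N) :=
  cube y ρ ×ˢ Ioc (s - τ) s

/-- `S ⋐ E`: the closure of `S` is compact and contained in `E`. -/
def CompactlyContained {N : ℕ} (S E : Set (SpaceTime N)) : Prop :=
  IsCompact (closure S) ∧ closure S ⊆ E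

/-- `g` is the weak (distributional) gradient of `f` in the open set `Ω ⊆ ℝ^N`:
`∫_Ω f ∂ᵢφ = - ∫_Ω gᵢ φ` for every `φ ∈ C_c^∞(Ω)` and every `i`. -/
def HasWeakGradient {N : ℕ} (Ω : Set (Space N)) (f : Space N → ℝ) (g : Space N → Space N) :
    Prop :=
  LocallyIntegrableOn f Ω ∧ LocallyIntegrableOn g Ω ∧
    ∀ φ : Space N → ℝ, ContDiff ℝ (⊤ : ℕ∞) φ → HasCompactSupport φ → tsupport φ ⊆ Ω →
      ∀ i : Fin N,
        ∫ x in Ω, f x * fderiv ℝ φ x (EuclideanSpace.single i 1) = - ∫ x in Ω, g x i * φ x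

/-- `G = Dw`, the weak gradient of `w` with respect to the space variables, in the cylinder
`K_ρ(y) × (s - τ, s]`: `G` is measurable there and for almost every time `t` the slice
`G(·,t)` is the weak gradient of `w(·,t)` in `K_ρ(y)`. It is unique up to null sets. -/
def HasSpatialGradient {N : ℕ} (y : Space N) (s ρ τ : ℝ) (w : SpaceTime N → ℝ)
    (G : SpaceTime N → Space N) : Prop :=
  AEStronglyMeasurable G (volume.restrict (cyl y s ρ τ)) ∧
    ∀ᵐ t ∂(volume.restrict (Ioo (s - τ) s)),
      HasWeakGradient (cube y ρ) (fun x => w (x, t)) (fun x => G (x, t))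

/-- `u ∈ L^∞(s - T, s; L^p(K_R(y)))`. -/
def MemLinftyLp {N : ℕ} (p : ℝ) (y : Space N) (s R T : ℝ) (u : SpaceTime N → ℝ) : Prop :=
  AEStronglyMeasurable u (volume.restrict (cyl y s R T)) ∧
    essSup (fun t => eLpNorm (fun x => u (x, t)) (ENNReal.ofReal p) (volume.restrict (cube y R)))
      (volume.restrict (Ioo (s - T) s)) < ∞

/-- `u ∈ L^p(s - T, s; W^{1,p}(K_R(y)))`: both `u` and its weak spatial gradient belong to
`L^p(K_R(y) × (s - T, s])`. -/
def MemLpSobolev {N : ℕ} (p : ℝ) (y : Space N) (s R T : ℝ) (u : SpaceTime N → ℝ) : Prop :=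
  MemLp u (ENNReal.ofReal p) (volume.restrict (cyl y s R T)) ∧
    ∃ G : SpaceTime N → Space N, HasSpatialGradient y s R T u G ∧
      MemLp G (ENNReal.ofReal p) (volume.restrict (cyl y s R T))

/-- `u ∈ C(s - T, s; L^p(K_R(y)))`: every slice `u(·,t)`, `s - T ≤ t ≤ s`, belongs to
`L^p(K_R(y))`, and `t ↦ u(·,t)` is continuous for the `L^p(K_R(y))` norm. -/
def MemContLp {N : ℕ} (p : ℝ) (y : Space N) (s R T : ℝ) (u : SpaceTime N → ℝ) : Prop :=
  (∀ t ∈ Icc (s - T) s,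
    MemLp (fun x => u (x, t)) (ENNReal.ofReal p) (volume.restrict (cube y R))) ∧
  ∀ t₀ ∈ Icc (s - T) s,
    Tendsto (fun t => eLpNorm (fun x => u (x, t) - u (x, t₀)) (ENNReal.ofReal p)
      (volume.restrict (cube y R))) (𝓝[Icc (s - T) s] t₀) (𝓝 0)

/-- `(u - k)_-`, the negative part of `u - k`. -/
def truncNeg {N : ℕ} (u : SpaceTime N → ℝ) (k : ℝ) : SpaceTime N → ℝ :=
  fun z => max (k - u z) 0

/-- `∫_{K_ρ(y)} (u - k)_-^p (·,t) dx`. -/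
noncomputable def sliceEnergy {N : ℕ} (p : ℝ) (u : SpaceTime N → ℝ) (k : ℝ) (y : Space N)
    (ρ t : ℝ) : ℝ≥0∞ :=
  ∫⁻ x in cube y ρ, ENNReal.ofReal (truncNeg u k (x, t) ^ p)

/-- `∬_{(y,s) + Q_{ρ,τ}} (u - k)_-^p dx dt`. -/
noncomputable def cylEnergy {N : ℕ} (p : ℝ) (u : SpaceTime N → ℝ) (k : ℝ) (y : Space N)
    (s ρ τ : ℝ) : ℝ≥0∞ :=
  ∫⁻ z in cyl y s ρ τ, ENNReal.ofReal (truncNeg u k z ^ p)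

/-- The parabolic De Giorgi class `𝔄_p^-(E,γ)`. -/
structure MemAMinus {N : ℕ} (p γ : ℝ) (E : Set (SpaceTime N)) (u : SpaceTime N → ℝ) :
    Prop where
  aemeasurable : AEMeasurable u (volume.restrict E)
  memLinftyLp : ∀ (y : Space N) (s R T : ℝ), 0 < R → 0 < T →
    CompactlyContained (cyl y s R T) E → MemLinftyLp p y s R T u
  memLpSobolev : ∀ (y : Space N) (s R T : ℝ), 0 < R → 0 < T →
    CompactlyContained (cyl y s R T) E → MemLpSobolev p y s R T u
  energy : ∀ (y : Space N) (s R T : ℝ), CompactlyContained (cyl y s R T) E →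
    ∀ ρ τ k : ℝ, 0 < ρ → ρ < R → 0 < τ → τ < T →
      ∃ G : SpaceTime N → Space N, HasSpatialGradient y s ρ τ (truncNeg u k) G ∧
        essSup (fun t => sliceEnergy p u k y ρ t) (volume.restrict (Ioo (s - τ) s))
            + ∫⁻ z in cyl y s ρ τ, ENNReal.ofReal (‖G z‖ ^ p)
          ≤ ENNReal.ofReal (γ / (R - ρ) ^ p + γ / (T - τ)) * cylEnergy p u k y s R T

/-- The parabolic De Giorgi class `𝔅_p^-(E,γ)`. -/
structure MemBMinus {N : ℕ} (p γ : ℝ) (E : Set (SpaceTime N)) (u : SpaceTime N → ℝ) :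
    Prop where
  memAMinus : MemAMinus p γ E u
  memContLp : ∀ (y : Space N) (s R T : ℝ), 0 < R → 0 < T →
    CompactlyContained (cyl y s R T) E → MemContLp p y s R T u
  initial : ∀ (y : Space N) (s R T : ℝ), 0 < T → CompactlyContained (cyl y s R T) E →
    ∀ ρ k : ℝ, 0 < ρ → ρ < R →
      essSup (fun t => sliceEnergy p u k y ρ t) (volume.restrict (Ioo (s - T) s))
        ≤ sliceEnergy p u k y R (s - T)
          + ENNReal.ofReal (γ / (R - ρ) ^ p) * cylEnergy p u k y s R T

end ParabolicDeGiorgi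

/-!
The proof alternates two steps on the cube `K_ρ(y)`, starting from a time at which `u > M` on a
fraction `3α/4` of the cube.

*Short time* (`volume_superlevel_ge`). The energy inequality with initial data bounds the growth of
the sublevel sets of `u`. If the waiting time is `δ ρ ^ p` with `δ` small, the fraction of the cube
where `u > ε M` stays above `α / 2`. Iterating this step alone would degrade the fraction and
could not reach an arbitrary time `A ρ ^ p`.

*Restart* (`exists_restart_level`). During the waiting interval each slice has a definite portion
above the level `ε M`, so De Giorgi's isoperimetric inequality (`volume_mul_volume_le`), integrated
in time and combined with the interior energy inequality, shows that the sublevel sets shrink. If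
`u ≤ η M` on a definite portion of the cube at almost every time, then each of the `n` dyadic bands
between `η M` and `ε M` has measure at least a fixed fraction of the cylinder (`volume_band_ge`).
The bands are disjoint, so this fails for `n` large. Hence at some time in the second half of the
interval `u > η M` on a fraction `3α/4` again, and the argument restarts at the level `η M`. Since
every round advances time by at least `δ ρ ^ p / 2`, a number of rounds depending only on `A` and
`δ` suffices (`volume_superlevel_ge_of_restart`).

The isoperimetric inequality is needed for a function that has only a weak gradient. It is obtained
by mollification: a Poincaré inequality (`lintegral_lintegral_enorm_sub_le`) is applied to a smooth
truncation `F` of the mollified function, whose gradient carries the factor `F'` supported in the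
intermediate set; this factor survives the limit by a Fatou argument
(`le_lintegral_of_eventually_le_mollify`), so no chain rule for weak gradients is used.

At the initial time only a part of the cube need lie in `E`. There `L^p` continuity on finitely many
small cubes moves the measure information to a slightly later time, halving the level
(`exists_initial_time`). Non-negativity is only needed on slices at almost every time
(`NonnegSlice`), and the times used are chosen among these.
-/

namespace ParabolicDeGiorgi

variable {N : ℕ}

/-! ### Cubes and cylinders -/

lemma mem_cube {y x : Space N} {r : ℝ} : x ∈ cube y r ↔ ∀ i, |x i - y i| < r := Iff.rfl

lemma cube_mono {y : Space N} {r R : ℝ} (h : r ≤ R) : cube y r ⊆ cube y R :=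
  fun _ hx i => (hx i).trans_le h

lemma isOpen_cube (y : Space N) (r : ℝ) : IsOpen (cube y r) := by
  have : cube y r = ⋂ i : Fin N, {x : Space N | |x i - y i| < r} := by
    ext x; simp [cube]
  rw [this]
  exact isOpen_iInter_of_finite fun i => isOpen_lt (by fun_prop) continuous_const

lemma measurableSet_cube (y : Space N) (r : ℝ) : MeasurableSet (cube y r) :=
  (isOpen_cube y r).measurableSet

lemma convex_cube (y : Space N) (r : ℝ) : Convex ℝ (cube y r) := by
  intro x hx z hz a b ha hb hab i
  have h : (a • x + b • z) i - y i = a * (x i - y i) + b * (z i - y i) := by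
    simp only [PiLp.add_apply, PiLp.smul_apply, smul_eq_mul]
    linear_combination (y i) * hab
  have h1 := abs_lt.1 (hx i)
  have h2 := abs_lt.1 (hz i)
  rw [h, abs_lt]
  rcases ha.eq_or_lt with rfl | ha'
  · have : b = 1 := by linarith
    subst this; constructor <;> nlinarith
  · constructor <;> nlinarith

/-- The closed counterpart of `cube`. -/
def closedCube (y : Space N) (r : ℝ) : Set (Space N) := {x | ∀ i, |x i - y i| ≤ r}

lemma cube_subset_closedCube (y : Space N) (r : ℝ) : cube y r ⊆ closedCube y r :=
  fun _ hx i => (hx i).le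

lemma closedCube_subset_cube {y : Space N} {r R : ℝ} (h : r < R) :
    closedCube y r ⊆ cube y R := fun _ hx i => (hx i).trans_lt h

lemma isClosed_closedCube (y : Space N) (r : ℝ) : IsClosed (closedCube y r) := by
  have : closedCube y r = ⋂ i : Fin N, {x : Space N | |x i - y i| ≤ r} := by
    ext x; simp [closedCube]
  rw [this]
  exact isClosed_iInter fun i => isClosed_le (by fun_prop) continuous_const

lemma norm_sub_le_of_abs_le {x z : Space N} {d : ℝ} (hd : 0 ≤ d) (h : ∀ i, |x i - z i| ≤ d) :
    ‖x - z‖ ≤ √N * d := by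
  rw [EuclideanSpace.norm_eq]
  calc √(∑ i, ‖(x - z) i‖ ^ 2) ≤ √(∑ _i : Fin N, d ^ 2) := by
        gcongr with i
        simpa [Real.norm_eq_abs] using h i
    _ = √N * d := by
        rw [Finset.sum_const, Finset.card_univ, Fintype.card_fin, nsmul_eq_mul,
          Real.sqrt_mul (by positivity), Real.sqrt_sq hd]

lemma isCompact_closedCube (y : Space N) (r : ℝ) : IsCompact (closedCube y r) := by
  refine Metric.isCompact_of_isClosed_isBounded (isClosed_closedCube y r) ?_
  refine (Metric.isBounded_closedBall (x := y) (r := √N * max r 0)).subset fun x hx => ?_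
  rw [Metric.mem_closedBall, dist_eq_norm]
  exact norm_sub_le_of_abs_le (le_max_right _ _) fun i => (hx i).trans (le_max_left _ _)

lemma abs_apply_le_norm (x : Space N) (i : Fin N) : |x i| ≤ ‖x‖ := by
  simpa using PiLp.norm_apply_le x i

lemma closedCube_subset_closedBall {y : Space N} {r : ℝ} (hr : 0 ≤ r) :
    closedCube y r ⊆ Metric.closedBall y (√N * r) := fun x hx => by
  rw [Metric.mem_closedBall, dist_eq_norm]
  exact norm_sub_le_of_abs_le hr hx

lemma volume_cube (y : Space N) (r : ℝ) :
    volume (cube y r) = ENNReal.ofReal (2 * r) ^ N := by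
  have hs : cube y r = (MeasurableEquiv.toLp 2 (Fin N → ℝ)).symm ⁻¹'
      (Set.univ.pi fun i => Ioo (y i - r) (y i + r)) := by
    ext x
    rw [mem_cube, mem_preimage, Set.mem_univ_pi]
    refine forall_congr' fun i => ?_
    rw [abs_lt]
    change _ ↔ y i - r < x i ∧ x i < y i + r
    constructor <;> rintro ⟨h1, h2⟩ <;> constructor <;> linarith
  rw [hs, (EuclideanSpace.volume_preserving_symm_measurableEquiv_toLp (Fin N)).measure_preimage_equiv,
    volume_pi_pi]
  simp only [Real.volume_Ioo]
  rw [Finset.prod_congr rfl (fun i _ => by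
    rw [show y i + r - (y i - r) = 2 * r by ring])]
  simp

lemma volume_cube_ne_top (y : Space N) (r : ℝ) : volume (cube y r) ≠ ∞ := by
  rw [volume_cube]; exact ENNReal.pow_ne_top ENNReal.ofReal_ne_top

lemma volume_cube_ne_zero (y : Space N) {r : ℝ} (hr : 0 < r) : volume (cube y r) ≠ 0 := by
  rw [volume_cube]; exact pow_ne_zero _ (by simpa using hr)

lemma volume_cube_mul (y : Space N) {c r : ℝ} (hc : 0 ≤ c) :
    volume (cube y (c * r)) = ENNReal.ofReal (c ^ N) * volume (cube y r) := by
  rw [volume_cube, volume_cube, ENNReal.ofReal_pow hc, ← mul_pow, ← ENNReal.ofReal_mul hc]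
  ring_nf

lemma measurableSet_cyl (y : Space N) (s r τ : ℝ) : MeasurableSet (cyl y s r τ) :=
  (measurableSet_cube y r).prod measurableSet_Ioc

lemma compactlyContained_cyl {E : Set (SpaceTime N)} {y : Space N} {s R T : ℝ}
    (h : closedCube y R ×ˢ Icc (s - T) s ⊆ E) : CompactlyContained (cyl y s R T) E := by
  have hc : IsCompact (closedCube y R ×ˢ Icc (s - T) s) :=
    (isCompact_closedCube y R).prod isCompact_Icc
  have hs : closure (cyl y s R T) ⊆ closedCube y R ×ˢ Icc (s - T) s :=
    closure_minimal (prod_mono (cube_subset_closedCube y R) Ioc_subset_Icc_self) hc.isClosed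
  exact ⟨hc.of_isClosed_subset isClosed_closure hs, hs.trans h⟩

/-! ### A Poincaré inequality for smooth functions on convex sets -/

lemma lintegral_comp_smul_add_le {h : Space N → ℝ≥0∞} (hh : Measurable h) {c : ℝ}
    (hc : 1 / 2 ≤ c) (v : Space N) :
    ∫⁻ x, h (c • x + v) ≤ 2 ^ N * ∫⁻ z, h z := by
  have hc0 : 0 < c := by linarith
  have h1 : ∫⁻ x, h (c • x + v) = ∫⁻ x, h (x + v) ∂(Measure.map (c • ·) volume) :=
    (lintegral_map (hh.comp (measurable_add_const v)) (measurable_const_smul c)).symm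
  rw [h1, Measure.map_addHaar_smul volume hc0.ne', lintegral_smul_measure,
    lintegral_add_right_eq_self, finrank_euclideanSpace_fin, smul_eq_mul]
  gcongr
  rw [abs_of_pos (by positivity), ← inv_pow, ENNReal.ofReal_pow (by positivity)]
  gcongr
  rw [← ENNReal.ofReal_ofNat]
  apply ENNReal.ofReal_le_ofReal
  rw [inv_le_comm₀ hc0 (by norm_num)]
  linarith

lemma lintegral_segment_le (K : Set (Space N)) {h : Space N → ℝ≥0∞}
    (hh : Measurable h) (t : ℝ) :
    ∫⁻ x in K, ∫⁻ z in K, h (x + t • (z - x)) ≤ 2 ^ N * volume K * ∫⁻ z, h z := by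
  rcases le_total (1 / 2) t with ht | ht
  · calc ∫⁻ x in K, ∫⁻ z in K, h (x + t • (z - x))
        ≤ ∫⁻ _x in K, 2 ^ N * ∫⁻ z, h z := by
          gcongr with x
          refine (setLIntegral_le_lintegral _ _).trans ?_
          have := lintegral_comp_smul_add_le hh ht (x - t • x)
          refine le_of_eq_of_le (lintegral_congr fun z => ?_) this
          congr 1; module
      _ = 2 ^ N * volume K * ∫⁻ z, h z := by
          rw [setLIntegral_const]; ring
  · rw [lintegral_lintegral_swap (by
      apply Measurable.aemeasurable
      exact hh.comp (by fun_prop))]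
    calc ∫⁻ z in K, ∫⁻ x in K, h (x + t • (z - x))
        ≤ ∫⁻ _z in K, 2 ^ N * ∫⁻ z, h z := by
          gcongr with z
          refine (setLIntegral_le_lintegral _ _).trans ?_
          have := lintegral_comp_smul_add_le hh (c := 1 - t) (by linarith) (t • z)
          refine le_of_eq_of_le (lintegral_congr fun x => ?_) this
          congr 1; module
      _ = 2 ^ N * volume K * ∫⁻ z, h z := by
          rw [setLIntegral_const]; ring

lemma enorm_sub_le_lintegral_fderiv {f : Space N → ℝ} (hf : ContDiff ℝ 1 f) (x z : Space N) :
    ‖f z - f x‖ₑ ≤ ‖z - x‖ₑ * ∫⁻ t in Icc (0 : ℝ) 1, ‖fderiv ℝ f (x + t • (z - x))‖ₑ := by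
  have hcont : Continuous fun t : ℝ => fderiv ℝ f (x + t • (z - x)) (z - x) :=
    ((hf.continuous_fderiv one_ne_zero).comp (by fun_prop)).clm_apply continuous_const
  have hd : ∀ t ∈ uIcc (0 : ℝ) 1, HasDerivAt (fun t : ℝ => f (x + t • (z - x)))
      (fderiv ℝ f (x + t • (z - x)) (z - x)) t := by
    intro t _
    have h1 : HasDerivAt (fun t : ℝ => x + t • (z - x)) (z - x) t := by
      simpa using ((hasDerivAt_id t).smul_const (z - x)).const_add x
    exact ((hf.differentiable one_ne_zero _).hasFDerivAt).comp_hasDerivAt t h1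
  have hftc := intervalIntegral.integral_eq_sub_of_hasDerivAt hd (hcont.intervalIntegrable 0 1)
  have h2 : f z - f x = ∫ t in (0 : ℝ)..1, fderiv ℝ f (x + t • (z - x)) (z - x) := by
    rw [hftc]; simp
  rw [h2, intervalIntegral.integral_of_le zero_le_one]
  refine (enorm_integral_le_lintegral_enorm _).trans ?_
  have hm : Measurable fun t : ℝ => ‖fderiv ℝ f (x + t • (z - x))‖ₑ :=
    ((hf.continuous_fderiv one_ne_zero).comp (by fun_prop)).enorm.measurable
  rw [← lintegral_const_mul _ hm]
  refine (lintegral_mono_set Ioc_subset_Icc_self).trans ?_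
  gcongr with t
  rw [mul_comm]
  exact ContinuousLinearMap.le_opENorm _ _

/-- Poincaré inequality in double-integral form. For a segment parameter `t ≥ 1/2` the map
`z ↦ x + t (z - x)` contracts volumes by a factor at least `2 ^ (-N)`; for `t ≤ 1/2` the same holds
with the roles of the two endpoints exchanged. -/
lemma lintegral_lintegral_enorm_sub_le {K : Set (Space N)} (hK : MeasurableSet K)
    (hconv : Convex ℝ K) {d : ℝ≥0∞} (hd : ∀ x ∈ K, ∀ z ∈ K, ‖z - x‖ₑ ≤ d)
    {f : Space N → ℝ} (hf : ContDiff ℝ 1 f) :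
    ∫⁻ x in K, ∫⁻ z in K, ‖f z - f x‖ₑ
      ≤ d * (2 ^ N * volume K) * ∫⁻ z in K, ‖fderiv ℝ f z‖ₑ := by
  set h : Space N → ℝ≥0∞ := K.indicator fun z => ‖fderiv ℝ f z‖ₑ with hh
  have hmeas : Measurable h :=
    ((hf.continuous_fderiv one_ne_zero).enorm.measurable).indicator hK
  have hm3 : Measurable fun q : (Space N × Space N) × ℝ => h (q.1.1 + q.2 • (q.1.2 - q.1.1)) :=
    hmeas.comp (by fun_prop)
  calc ∫⁻ x in K, ∫⁻ z in K, ‖f z - f x‖ₑ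
      ≤ ∫⁻ x in K, ∫⁻ z in K, d * ∫⁻ t in Icc (0 : ℝ) 1, h (x + t • (z - x)) := by
        refine setLIntegral_mono' hK fun x hx => setLIntegral_mono' hK fun z hz => ?_
        refine (enorm_sub_le_lintegral_fderiv hf x z).trans ?_
        refine mul_le_mul' (hd x hx z hz) (setLIntegral_mono' measurableSet_Icc fun t ht => ?_)
        rw [hh, indicator_of_mem (hconv.add_smul_sub_mem hx hz ht)]
    _ = d * ∫⁻ x in K, ∫⁻ z in K, ∫⁻ t in Icc (0 : ℝ) 1, h (x + t • (z - x)) := by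
        have hmz : Measurable fun q : Space N × Space N =>
            ∫⁻ t in Icc (0 : ℝ) 1, h (q.1 + t • (q.2 - q.1)) := hm3.lintegral_prod_right'
        have hx : ∀ x, Measurable fun z : Space N =>
            ∫⁻ t in Icc (0 : ℝ) 1, h (x + t • (z - x)) :=
          fun x => hmz.comp measurable_prodMk_left
        have hxx : Measurable fun x : Space N =>
            ∫⁻ z in K, ∫⁻ t in Icc (0 : ℝ) 1, h (x + t • (z - x)) := hmz.lintegral_prod_right'
        rw [← lintegral_const_mul _ hxx]
        exact lintegral_congr fun x => lintegral_const_mul _ (hx x)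
    _ = d * ∫⁻ x in K, ∫⁻ t in Icc (0 : ℝ) 1, ∫⁻ z in K, h (x + t • (z - x)) := by
        congr 1
        refine lintegral_congr fun x => lintegral_lintegral_swap ?_
        exact (hm3.comp (by fun_prop :
          Measurable fun q : Space N × ℝ => ((x, q.1), q.2))).aemeasurable
    _ = d * ∫⁻ t in Icc (0 : ℝ) 1, ∫⁻ x in K, ∫⁻ z in K, h (x + t • (z - x)) := by
        congr 1
        refine lintegral_lintegral_swap (Measurable.aemeasurable ?_)
        have h1 : Measurable fun q : (Space N × ℝ) × Space N =>
            h (q.1.1 + q.1.2 • (q.2 - q.1.1)) := hmeas.comp (by fun_prop)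
        exact h1.lintegral_prod_right'
    _ ≤ d * ∫⁻ _t in Icc (0 : ℝ) 1, 2 ^ N * volume K * ∫⁻ z, h z := by
        gcongr with t
        exact lintegral_segment_le K hmeas t
    _ = d * (2 ^ N * volume K) * ∫⁻ z in K, ‖fderiv ℝ f z‖ₑ := by
        rw [setLIntegral_const, Real.volume_Icc, hh, lintegral_indicator hK]
        simp [mul_assoc]

/-- The smooth transition function rescaled to the interval `[0, b]`: a smooth substitute for the
truncation `min (v / b) 1` of `v ≥ 0`, equal to `0` for `v ≤ 0` and to `1` for `v ≥ b`. -/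
noncomputable def ramp (b v : ℝ) : ℝ := Real.smoothTransition (v / b)

lemma contDiff_ramp (b : ℝ) : ContDiff ℝ 1 (ramp b) :=
  Real.smoothTransition.contDiff.comp (contDiff_id.div_const b)

lemma ramp_of_nonpos {b v : ℝ} (hb : 0 < b) (hv : v ≤ 0) : ramp b v = 0 :=
  Real.smoothTransition.zero_of_nonpos (div_nonpos_of_nonpos_of_nonneg hv hb.le)

lemma ramp_of_le {b v : ℝ} (hb : 0 < b) (hv : b ≤ v) : ramp b v = 1 :=
  Real.smoothTransition.one_of_one_le ((one_le_div hb).2 hv)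

lemma deriv_ramp_eq_zero {b v : ℝ} (hb : 0 < b) (hv : ¬ (0 < v ∧ v < b)) :
    deriv (ramp b) v = 0 := by
  rcases le_or_gt v 0 with h | h
  · have : IsLocalMin (ramp b) v := Eventually.of_forall fun w => by
      rw [ramp_of_nonpos hb h]; exact Real.smoothTransition.nonneg _
    exact this.deriv_eq_zero
  · have h' : b ≤ v := not_lt.1 fun h' => hv ⟨h, h'⟩
    have : IsLocalMax (ramp b) v := Eventually.of_forall fun w => by
      rw [ramp_of_le hb h']; exact Real.smoothTransition.le_one _
    exact this.deriv_eq_zero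

lemma exists_abs_deriv_smoothTransition_le :
    ∃ L : ℝ, 0 < L ∧ ∀ v, |deriv Real.smoothTransition v| ≤ L := by
  have hc : Continuous (deriv Real.smoothTransition) :=
    (Real.smoothTransition.contDiff (n := 1)).continuous_deriv le_rfl
  obtain ⟨L, hL⟩ := (isCompact_Icc (a := (0 : ℝ)) (b := 1)).exists_bound_of_continuousOn
    hc.continuousOn
  refine ⟨max L 1, by positivity, fun v => ?_⟩
  by_cases hv : v ∈ Icc (0 : ℝ) 1
  · exact (hL v hv).trans (le_max_left _ _)
  · have h0 : deriv (ramp 1) v = 0 :=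
      deriv_ramp_eq_zero one_pos fun h => hv ⟨h.1.le, h.2.le⟩
    have h1 : ramp 1 = Real.smoothTransition := by ext; simp [ramp]
    rw [h1] at h0
    rw [h0, abs_zero]; positivity

/-- A universal Lipschitz constant of the smooth transition function. -/
noncomputable def rampConst : ℝ := exists_abs_deriv_smoothTransition_le.choose

lemma rampConst_pos : 0 < rampConst := exists_abs_deriv_smoothTransition_le.choose_spec.1

lemma abs_deriv_ramp_le {b : ℝ} (hb : 0 < b) (v : ℝ) : |deriv (ramp b) v| ≤ rampConst / b := by
  have h : HasDerivAt (ramp b) (deriv Real.smoothTransition (v / b) * (1 / b)) v := by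
    have h1 : HasDerivAt Real.smoothTransition (deriv Real.smoothTransition (v / b)) (v / b) :=
      ((Real.smoothTransition.contDiff (n := 1)).differentiable one_ne_zero _).hasDerivAt
    exact h1.comp v ((hasDerivAt_id v).div_const b)
  rw [h.deriv, abs_mul, abs_of_pos (by positivity : 0 < 1 / b), mul_one_div]
  gcongr
  exact exists_abs_deriv_smoothTransition_le.choose_spec.2 _

/-! ### Mollification of functions with a weak gradient -/

section Mollify
open ContinuousLinearMap
open scoped Convolution

/-- The mollification of `w` with the normalized bump function `φ`. -/
noncomputable def mollify {F : Type*} [NormedAddCommGroup F] [NormedSpace ℝ F]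
    (φ : ContDiffBump (0 : Space N)) (w : Space N → F) : Space N → F :=
  φ.normed volume ⋆[lsmul ℝ ℝ, volume] w

variable {F : Type*} [NormedAddCommGroup F] [NormedSpace ℝ F] {w : Space N → F}
  (φ : ContDiffBump (0 : Space N))

lemma mollify_apply (x : Space N) :
    mollify φ w x = ∫ t, φ.normed volume (x - t) • w t := by
  rw [mollify, convolution_lsmul_swap]

lemma contDiff_mollify {w : Space N → ℝ} (hw : Integrable w) : ContDiff ℝ 1 (mollify φ w) :=
  φ.hasCompactSupport_normed.contDiff_convolution_left (n := 1) _ φ.contDiff_normed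
    hw.locallyIntegrable

lemma integrable_mollify (hw : Integrable w) : Integrable (mollify φ w) :=
  φ.integrable_normed.integrable_convolution _ hw

lemma norm_mollify_le (x : Space N) : ‖mollify φ w x‖ ≤ mollify φ (fun z => ‖w z‖) x := by
  rw [mollify_apply, mollify_apply]
  refine (norm_integral_le_integral_norm _).trans (le_of_eq ?_)
  congr 1; ext t
  rw [norm_smul, Real.norm_of_nonneg (φ.nonneg_normed _), smul_eq_mul]

lemma integral_mollify {w : Space N → ℝ} (hw : Integrable w) :
    ∫ x, mollify φ w x = ∫ x, w x := by
  rw [mollify, integral_convolution (L := lsmul ℝ ℝ) φ.integrable_normed hw, φ.integral_normed]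
  simp

/-- Inside `cube y r` the classical gradient of the mollification is the mollification of the weak
gradient; cutting off outside `cube y ρ` is not seen there when the bump has radius `< ρ - r`. -/
lemma fderiv_mollify {y : Space N} {r ρ R : ℝ} (hR : ρ < R)
    {f : Space N → ℝ} {g : Space N → Space N} (h : HasWeakGradient (cube y R) f g)
    (hf : Integrable ((cube y ρ).indicator f)) (hg : Integrable ((cube y ρ).indicator g))
    (hφ : φ.rOut < ρ - r) {x : Space N} (hx : x ∈ cube y r) (i : Fin N) :
    fderiv ℝ (mollify φ ((cube y ρ).indicator f)) x (EuclideanSpace.single i 1)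
      = mollify φ ((cube y ρ).indicator g) x i := by
  set ψ : Space N → ℝ := fun t => φ.normed volume (x - t) with hψ
  have hψc : ContDiff ℝ (⊤ : ℕ∞) ψ := φ.contDiff_normed.comp (contDiff_const.sub contDiff_id)
  have hψ0 : ∀ t, t ∉ Metric.closedBall x φ.rOut → ψ t = 0 := fun t ht => by
    have : x - t ∉ Function.support (φ.normed volume) := by
      rw [φ.support_normed_eq, mem_ball_zero_iff, ← dist_eq_norm, dist_comm]
      exact fun h => ht (Metric.ball_subset_closedBall h)
    exact Function.notMem_support.1 this
  have hts : tsupport ψ ⊆ Metric.closedBall x φ.rOut :=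
    closure_minimal (fun t ht => by_contra fun h' => ht (hψ0 t h')) Metric.isClosed_closedBall
  have hball : Metric.closedBall x φ.rOut ⊆ cube y ρ := fun t ht j => by
    have h1 : |t j - x j| ≤ φ.rOut :=
      (abs_apply_le_norm (t - x) j).trans (mem_closedBall_iff_norm.1 ht)
    have h2 := hx j
    calc |t j - y j| = |(t j - x j) + (x j - y j)| := by ring_nf
      _ ≤ |t j - x j| + |x j - y j| := abs_add_le _ _
      _ < ρ := by linarith
  have hcs : HasCompactSupport ψ :=
    (isCompact_closedBall x φ.rOut).of_isClosed_subset (isClosed_tsupport ψ) hts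
  have hweak := h.2.2 ψ hψc hcs ((hts.trans hball).trans (cube_mono hR.le)) i
  have hfd : ∀ t, fderiv ℝ ψ t = - fderiv ℝ (φ.normed volume) (x - t) := fun t => by
    have h1 : HasFDerivAt (fun t : Space N => x - t) (-(ContinuousLinearMap.id ℝ (Space N))) t := by
      simpa using (hasFDerivAt_id t).const_sub x
    have h2 : HasFDerivAt (φ.normed volume) (fderiv ℝ (φ.normed volume) (x - t)) (x - t) :=
      ((φ.contDiff_normed (n := 1)).differentiable one_ne_zero _).hasFDerivAt
    have := (h2.comp t h1).fderiv
    rw [hψ]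
    refine this.trans ?_
    ext v; simp
  have hfd0 : ∀ t, t ∉ Metric.closedBall x φ.rOut → fderiv ℝ ψ t = 0 := fun t ht =>
    Function.notMem_support.1 fun h' => ht (hts (support_fderiv_subset ℝ h'))
  -- the two sides of the weak formulation only see the cube `cube y ρ`
  have hL : ∫ t in cube y R, f t * fderiv ℝ ψ t (EuclideanSpace.single i 1)
      = ∫ t, (cube y ρ).indicator f t * fderiv ℝ ψ t (EuclideanSpace.single i 1) := by
    rw [← integral_indicator (measurableSet_cube y R)]
    congr 1; ext t
    by_cases ht : t ∈ Metric.closedBall x φ.rOut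
    · rw [indicator_of_mem (cube_mono hR.le (hball ht)), indicator_of_mem (hball ht)]
    · simp [hfd0 t ht]
  have hRt : ∫ t in cube y R, g t i * ψ t = ∫ t, (cube y ρ).indicator g t i * ψ t := by
    rw [← integral_indicator (measurableSet_cube y R)]
    congr 1; ext t
    by_cases ht : t ∈ Metric.closedBall x φ.rOut
    · rw [indicator_of_mem (cube_mono hR.le (hball ht)), indicator_of_mem (hball ht)]
    · simp [hψ0 t ht]
  rw [hL, hRt] at hweak
  have hflip : mollify φ ((cube y ρ).indicator f)
      = (cube y ρ).indicator f ⋆[(lsmul ℝ ℝ).flip, volume] φ.normed volume := by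
    rw [mollify, convolution_flip]
  have hderiv := φ.hasCompactSupport_normed (μ := volume) |>.hasFDerivAt_convolution_right
    (lsmul ℝ ℝ : ℝ →L[ℝ] ℝ →L[ℝ] ℝ).flip hf.locallyIntegrable (φ.contDiff_normed (n := 1)) x
  rw [hflip, hderiv.fderiv, convolution_precompR_apply _ hf.locallyIntegrable
    (φ.hasCompactSupport_normed.fderiv ℝ)
    ((φ.contDiff_normed (n := 1)).continuous_fderiv one_ne_zero), convolution_def]
  have h1 : ∫ t, (lsmul ℝ ℝ : ℝ →L[ℝ] ℝ →L[ℝ] ℝ).flip ((cube y ρ).indicator f t)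
      (fderiv ℝ (φ.normed volume) (x - t) (EuclideanSpace.single i 1))
      = - ∫ t, (cube y ρ).indicator f t * fderiv ℝ ψ t (EuclideanSpace.single i 1) := by
    rw [← integral_neg]
    congr 1; ext t
    rw [hfd]; simp [mul_comm]
  rw [h1, hweak, neg_neg, mollify_apply]
  have hint : Integrable fun t => φ.normed volume (x - t) • (cube y ρ).indicator g t := by
    have := (φ.hasCompactSupport_normed (μ := volume)).convolutionExists_left (lsmul ℝ ℝ)
      (φ.continuous_normed) hg.locallyIntegrable x
    exact (convolutionExistsAt_iff_integrable_swap.1 this)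
  have := (EuclideanSpace.proj i : Space N →L[ℝ] ℝ).integral_comp_comm hint
  refine Eq.trans ?_ this
  congr 1; ext t
  simp [hψ, mul_comm]

end Mollify

lemma enorm_le_of_apply_single {L : Space N →L[ℝ] ℝ} {v : Space N}
    (h : ∀ i, L (EuclideanSpace.single i 1) = v i) : ‖L‖ₑ ≤ ‖v‖ₑ := by
  have hL : ∀ z, L z = inner ℝ v z := by
    intro z
    have : L = innerSL ℝ v := by
      apply ContinuousLinearMap.coe_injective
      refine (EuclideanSpace.basisFun (Fin N) ℝ).toBasis.ext fun i => ?_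
      simp [h i, EuclideanSpace.inner_single_right]
    rw [this]; rfl
  have : ‖L‖ ≤ ‖v‖ := L.opNorm_le_bound (norm_nonneg _) fun z => by
    rw [hL]; exact norm_inner_le_norm v z
  rw [← ofReal_norm, ← ofReal_norm]
  exact ENNReal.ofReal_le_ofReal this

/-! ### De Giorgi's isoperimetric inequality for weakly differentiable functions -/

/-- Bump functions with supports shrinking to the origin. -/
noncomputable def shrinkingBump (n : ℕ) : ContDiffBump (0 : Space N) where
  rIn := 1 / (n + 1) / 2
  rOut := 1 / (n + 1)
  rIn_pos := by positivity
  rIn_lt_rOut := half_lt_self (by positivity)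

lemma tendsto_rOut_shrinkingBump :
    Tendsto (fun n => (shrinkingBump (N := N) n).rOut) atTop (𝓝 0) :=
  tendsto_one_div_add_atTop_nhds_zero_nat

lemma ae_tendsto_mollify {F : Type*} [NormedAddCommGroup F] [NormedSpace ℝ F] [CompleteSpace F]
    {w : Space N → F} (hw : Integrable w) :
    ∀ᵐ x, Tendsto (fun n => mollify (shrinkingBump n) w x) atTop (𝓝 (w x)) := by
  refine ContDiffBump.ae_convolution_tendsto_right_of_locallyIntegrable (K := 2)
    tendsto_rOut_shrinkingBump (Eventually.of_forall fun n => ?_) hw.locallyIntegrable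
  simp only [shrinkingBump]; linarith

/-- If `D ≥ |h|` and `c ≤ a ∫ |h (w_n)| |G_n|` for the mollifications `w_n`, `G_n` of `w`, `G` and
all large `n`, then the same bound holds for `w` and `G`. This is Fatou's lemma applied to
`D (|G|)_n - |h (w_n)| |G_n| ≥ 0`, whose first term has constant integral. -/
lemma le_lintegral_of_eventually_le_mollify {w : Space N → ℝ} {G : Space N → Space N}
    (hw : Integrable w) (hG : Integrable G) {h : ℝ → ℝ} (hh : Continuous h) {D : ℝ}
    (hD : ∀ v, |h v| ≤ D) {a c : ℝ≥0∞} (ha : a ≠ ∞)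
    (hc : ∀ᶠ n in atTop, c ≤ a * ∫⁻ x, ENNReal.ofReal
      (|h (mollify (shrinkingBump n) w x)| * ‖mollify (shrinkingBump n) G x‖)) :
    c ≤ a * ∫⁻ x, ENNReal.ofReal (|h (w x)| * ‖G x‖) := by
  have hD0 : 0 ≤ D := (abs_nonneg _).trans (hD 0)
  set q : ℕ → Space N → ℝ := fun n x =>
    |h (mollify (shrinkingBump n) w x)| * ‖mollify (shrinkingBump n) G x‖ with hq
  set H : ℕ → Space N → ℝ := fun n x => D * mollify (shrinkingBump n) (fun z => ‖G z‖) x with hH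
  have hqH : ∀ n x, q n x ≤ H n x := fun n x =>
    mul_le_mul (hD _) (norm_mollify_le _ x) (norm_nonneg _) hD0
  have hq0 : ∀ n x, 0 ≤ q n x := fun n x => mul_nonneg (abs_nonneg _) (norm_nonneg _)
  have hqm : ∀ n, AEMeasurable (q n) := fun n =>
    ((hh.abs.comp_aestronglyMeasurable (integrable_mollify _ hw).1).mul
      (integrable_mollify _ hG).1.norm).aemeasurable
  have hHi : ∀ n, Integrable (H n) := fun n => (integrable_mollify _ hG.norm).const_mul D
  set T : ℝ≥0∞ := ENNReal.ofReal (∫ x, D * ‖G x‖) with hT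
  have hHT : ∀ n, ∫⁻ x, ENNReal.ofReal (H n x) = T := fun n => by
    rw [← ofReal_integral_eq_lintegral_ofReal (hHi n)
      (Eventually.of_forall fun x => (hq0 n x).trans (hqH n x)), hT]
    simp only [hH]
    rw [integral_const_mul, integral_const_mul, integral_mollify _ hG.norm]
  have hsplit : ∀ n, (∫⁻ x, ENNReal.ofReal (H n x - q n x)) + ∫⁻ x, ENNReal.ofReal (q n x) = T := by
    intro n
    rw [← hHT n, ← lintegral_add_right' _ (hqm n).ennreal_ofReal]
    refine lintegral_congr fun x => ?_
    rw [← ENNReal.ofReal_add (sub_nonneg.2 (hqH n x)) (hq0 n x), sub_add_cancel]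
  have hlim : ∀ᵐ x, Tendsto (fun n => ENNReal.ofReal (H n x - q n x)) atTop
      (𝓝 (ENNReal.ofReal (D * ‖G x‖ - |h (w x)| * ‖G x‖))) := by
    filter_upwards [ae_tendsto_mollify hw, ae_tendsto_mollify hG, ae_tendsto_mollify hG.norm]
      with x h1 h2 h3
    exact (ENNReal.continuous_ofReal.tendsto _).comp ((h3.const_mul D).sub
      ((((hh.tendsto _).comp h1).abs).mul h2.norm))
  have hfatou : ∫⁻ x, ENNReal.ofReal (D * ‖G x‖ - |h (w x)| * ‖G x‖)
      ≤ liminf (fun n => ∫⁻ x, ENNReal.ofReal (H n x - q n x)) atTop := by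
    refine le_trans (le_of_eq (lintegral_congr_ae ?_)) (lintegral_liminf_le' fun n =>
      ((hHi n).1.aemeasurable.sub (hqm n)).ennreal_ofReal)
    filter_upwards [hlim] with x hx using hx.liminf_eq.symm
  have hTtop : T ≠ ∞ := ENNReal.ofReal_ne_top
  have hsplit' : (∫⁻ x, ENNReal.ofReal (D * ‖G x‖ - |h (w x)| * ‖G x‖))
      + ∫⁻ x, ENNReal.ofReal (|h (w x)| * ‖G x‖) = T := by
    have hm : AEMeasurable fun x => |h (w x)| * ‖G x‖ :=
      ((hh.abs.comp_aestronglyMeasurable hw.1).mul hG.1.norm).aemeasurable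
    rw [hT, ofReal_integral_eq_lintegral_ofReal (hG.norm.const_mul D)
      (Eventually.of_forall fun x => mul_nonneg hD0 (norm_nonneg _)),
      ← lintegral_add_right' _ hm.ennreal_ofReal]
    refine lintegral_congr fun x => ?_
    rw [← ENNReal.ofReal_add, sub_add_cancel]
    · rw [← sub_mul]; exact mul_nonneg (sub_nonneg.2 (hD _)) (norm_nonneg _)
    · positivity
  set I₀ := ∫⁻ x, ENNReal.ofReal (D * ‖G x‖ - |h (w x)| * ‖G x‖)
  set I₁ := ∫⁻ x, ENNReal.ofReal (|h (w x)| * ‖G x‖)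
  have hI₀ : I₀ ≠ ∞ := ne_top_of_le_ne_top hTtop (hsplit' ▸ le_self_add)
  have hkey : a * I₀ + c ≤ a * T := by
    have h1 : ∀ᶠ n in atTop, a * ∫⁻ x, ENNReal.ofReal (H n x - q n x) ≤ a * T - c := by
      filter_upwards [hc] with n hn
      have hle : a * ∫⁻ x, ENNReal.ofReal (q n x) ≤ a * T := by
        gcongr; rw [← hsplit n]; exact le_add_self
      have hct : c ≠ ∞ := ne_top_of_le_ne_top (ENNReal.mul_ne_top ha hTtop) (hn.trans hle)
      refine ENNReal.le_sub_of_add_le_right hct ?_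
      calc _ ≤ a * (∫⁻ x, ENNReal.ofReal (H n x - q n x))
            + a * ∫⁻ x, ENNReal.ofReal (q n x) := by gcongr
        _ = a * T := by rw [← mul_add, hsplit n]
    have h2 : a * I₀ ≤ a * T - c := by
      calc a * I₀ ≤ a * liminf (fun n => ∫⁻ x, ENNReal.ofReal (H n x - q n x)) atTop := by
            gcongr
        _ = liminf (fun n => a * ∫⁻ x, ENNReal.ofReal (H n x - q n x)) atTop :=
            (ENNReal.liminf_const_mul_of_ne_top ha).symm
        _ ≤ a * T - c := by
            refine liminf_le_of_le (by isBoundedDefault) fun b hb => ?_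
            obtain ⟨n, hn⟩ := (hb.and h1).exists
            exact hn.1.trans hn.2
    have hcT : c ≤ a * T := by
      obtain ⟨n, hn⟩ := hc.exists
      refine hn.trans ?_
      gcongr; rw [← hsplit n]; exact le_add_self
    calc a * I₀ + c ≤ (a * T - c) + c := by gcongr
      _ = a * T := tsub_add_cancel_of_le hcT
  rw [← hsplit', mul_add] at hkey
  exact (ENNReal.add_le_add_iff_left (ENNReal.mul_ne_top ha hI₀)).1 hkey

/-- The dimensional constant of the isoperimetric inequality. -/
noncomputable def isoConst (N : ℕ) : ℝ := 2 * (√N + 1) * 2 ^ N * rampConst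

lemma isoConst_pos (N : ℕ) : 0 < isoConst N := by
  have := rampConst_pos
  unfold isoConst; positivity

/-- De Giorgi's isoperimetric inequality: the measures of the two sets where `f ≤ 0` and `f ≥ b` are
controlled by the gradient on the intermediate set `0 < f < b` alone. The gradient may be weak, at
the price of a slightly larger cube on the right-hand side. -/
lemma volume_mul_volume_le {y : Space N} {r R : ℝ} (hr : 0 < r) (hrR : r < R)
    {f : Space N → ℝ} {g : Space N → Space N} (h : HasWeakGradient (cube y R) f g)
    {b : ℝ} (hb : 0 < b) :
    volume {x ∈ cube y r | b ≤ f x} * volume {x ∈ cube y r | f x ≤ 0}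
      ≤ ENNReal.ofReal (isoConst N * r / b) * volume (cube y r) *
        ∫⁻ x in cube y R, {x | 0 < f x ∧ f x < b}.indicator (fun x => ‖g x‖ₑ) x := by
  obtain ⟨ρ, hrρ, hρR⟩ := exists_between hrR
  set K := cube y r with hK
  have hKm : MeasurableSet K := measurableSet_cube y r
  set μ := (volume : Measure (Space N)).restrict K with hμ
  set w : Space N → ℝ := (cube y ρ).indicator f with hw
  set G : Space N → Space N := (cube y ρ).indicator g with hG
  have hsub : closedCube y ρ ⊆ cube y R := closedCube_subset_cube hρR
  have hwi : Integrable w := (integrable_indicator_iff (measurableSet_cube y ρ)).2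
    ((h.1.integrableOn_compact_subset hsub (isCompact_closedCube y ρ)).mono_set
      (cube_subset_closedCube y ρ))
  have hGi : Integrable G := (integrable_indicator_iff (measurableSet_cube y ρ)).2
    ((h.2.1.integrableOn_compact_subset hsub (isCompact_closedCube y ρ)).mono_set
      (cube_subset_closedCube y ρ))
  have hwf : ∀ x ∈ K, w x = f x := fun x hx => indicator_of_mem (cube_mono hrρ.le hx) f
  set F := ramp b with hF
  have hFc : Continuous F := (contDiff_ramp b).continuous
  set d : ℝ≥0∞ := ENNReal.ofReal (2 * (√N + 1) * r) with hd
  set a : ℝ≥0∞ := d * (2 ^ N * volume K) with ha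
  have ha_top : a ≠ ∞ := ENNReal.mul_ne_top ENNReal.ofReal_ne_top
    (ENNReal.mul_ne_top (by finiteness) (volume_cube_ne_top y r))
  have hdiam : ∀ x ∈ K, ∀ z ∈ K, ‖z - x‖ₑ ≤ d := by
    intro x hx z hz
    rw [← ofReal_norm]
    refine ENNReal.ofReal_le_ofReal ?_
    refine (norm_sub_le_of_abs_le (d := 2 * r) (by positivity) fun i => ?_).trans ?_
    · have h1 := hx i
      have h2 := hz i
      rw [abs_lt] at h1 h2
      rw [abs_le]
      constructor <;> linarith
    · nlinarith [Real.sqrt_nonneg (N : ℝ)]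
  -- the double integral of the truncation dominates the product of measures
  have hwm : AEMeasurable w μ := hwi.1.aemeasurable.restrict
  have hFm : AEMeasurable (fun x => F (w x)) μ := hFc.measurable.comp_aemeasurable hwm
  have hlow : volume {x ∈ K | b ≤ f x} * volume {x ∈ K | f x ≤ 0}
      ≤ ∫⁻ x, ∫⁻ z, ‖F (w z) - F (w x)‖ₑ ∂μ ∂μ := by
    have hA : volume {x ∈ K | f x ≤ 0} = μ {x | w x ≤ 0} := by
      rw [hμ, Measure.restrict_apply' hKm]
      congr 1; ext x
      constructor
      · rintro ⟨h1, h2⟩; exact ⟨by simpa [hwf x h1] using h2, h1⟩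
      · rintro ⟨h1, h2⟩; exact ⟨h2, by simpa [hwf x h2] using h1⟩
    have hB : volume {x ∈ K | b ≤ f x} = μ {x | b ≤ w x} := by
      rw [hμ, Measure.restrict_apply' hKm]
      congr 1; ext x
      constructor
      · rintro ⟨h1, h2⟩; exact ⟨by simpa [hwf x h1] using h2, h1⟩
      · rintro ⟨h1, h2⟩; exact ⟨h2, by simpa [hwf x h2] using h1⟩
    rw [hA, hB]
    have hmeas2 : AEMeasurable (fun q : Space N × Space N => ‖F (w q.2) - F (w q.1)‖ₑ)
        (μ.prod μ) :=
      (hFm.comp_snd.sub hFm.comp_fst).enorm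
    refine le_trans ?_ (mul_meas_ge_le_lintegral₀ hmeas2.lintegral_prod_right' (μ {x | b ≤ w x}))
    refine mul_le_mul' le_rfl (measure_mono fun x hx => ?_)
    have hx' : w x ≤ 0 := hx
    change μ {x | b ≤ w x} ≤ ∫⁻ z, ‖F (w z) - F (w x)‖ₑ ∂μ
    have h1 := mul_meas_ge_le_lintegral₀ (μ := μ) (f := fun z => ‖F (w z) - F (w x)‖ₑ)
      (hFm.sub_const _).enorm 1
    rw [one_mul] at h1
    refine le_trans (measure_mono fun z hz => ?_) h1
    have hz' : b ≤ w z := hz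
    simp [hF, ramp_of_le hb hz', ramp_of_nonpos hb hx']
  -- Poincaré for the mollifications
  have hmol : ∀ᶠ n in atTop, ∫⁻ x, ∫⁻ z, ‖F (mollify (shrinkingBump n) w z)
      - F (mollify (shrinkingBump n) w x)‖ₑ ∂μ ∂μ
      ≤ a * ∫⁻ x, ENNReal.ofReal (|deriv F (mollify (shrinkingBump n) w x)| *
        ‖mollify (shrinkingBump n) G x‖) := by
    have hev : ∀ᶠ n in atTop, (shrinkingBump (N := N) n).rOut < ρ - r :=
      tendsto_rOut_shrinkingBump.eventually_lt_const (sub_pos.2 hrρ)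
    filter_upwards [hev] with n hn
    have hsm : ContDiff ℝ 1 (mollify (shrinkingBump n) w) := contDiff_mollify _ hwi
    have hcomp : ContDiff ℝ 1 (fun x => F (mollify (shrinkingBump n) w x)) :=
      (contDiff_ramp b).comp hsm
    refine (lintegral_lintegral_enorm_sub_le hKm (convex_cube y r) hdiam hcomp).trans ?_
    refine mul_le_mul' le_rfl ?_
    refine le_trans (setLIntegral_mono' hKm fun x hx => ?_) (setLIntegral_le_lintegral K _)
    have hfd : HasFDerivAt (fun x => F (mollify (shrinkingBump n) w x))
        (deriv F (mollify (shrinkingBump n) w x) • fderiv ℝ (mollify (shrinkingBump n) w) x) x :=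
      (((contDiff_ramp b).differentiable one_ne_zero _).hasDerivAt).comp_hasFDerivAt x
        ((hsm.differentiable one_ne_zero _).hasFDerivAt)
    rw [hfd.fderiv, enorm_smul, ENNReal.ofReal_mul (abs_nonneg _), ← Real.enorm_eq_ofReal_abs,
      ofReal_norm]
    gcongr
    exact enorm_le_of_apply_single fun i => fderiv_mollify _ hρR h hwi hGi hn hx i
  have hae : ∀ᵐ x ∂μ, Tendsto (fun n => mollify (shrinkingBump n) w x) atTop (𝓝 (w x)) :=
    ae_restrict_of_ae (ae_tendsto_mollify hwi)
  have hfat : ∫⁻ x, ∫⁻ z, ‖F (w z) - F (w x)‖ₑ ∂μ ∂μ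
      ≤ liminf (fun n => ∫⁻ x, ∫⁻ z, ‖F (mollify (shrinkingBump n) w z)
        - F (mollify (shrinkingBump n) w x)‖ₑ ∂μ ∂μ) atTop := by
    set Q : ℕ → Space N × Space N → ℝ≥0∞ := fun n q =>
      ‖F (mollify (shrinkingBump n) w q.2) - F (mollify (shrinkingBump n) w q.1)‖ₑ with hQ
    have hQm : ∀ n, Measurable (Q n) := fun n => by
      have := (contDiff_mollify (shrinkingBump n) hwi).continuous
      exact ((hFc.comp (this.comp continuous_snd)).sub
        (hFc.comp (this.comp continuous_fst))).enorm.measurable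
    have hpt : ∀ᵐ x ∂μ, ∀ᵐ z ∂μ,
        ‖F (w z) - F (w x)‖ₑ ≤ liminf (fun n => Q n (x, z)) atTop := by
      filter_upwards [hae] with x hx
      filter_upwards [hae] with z hz
      have : Tendsto (fun n => Q n (x, z)) atTop (𝓝 ‖F (w z) - F (w x)‖ₑ) :=
        (((hFc.tendsto _).comp hz).sub ((hFc.tendsto _).comp hx)).enorm
      exact this.liminf_eq.ge
    calc ∫⁻ x, ∫⁻ z, ‖F (w z) - F (w x)‖ₑ ∂μ ∂μ
        ≤ ∫⁻ x, liminf (fun n => ∫⁻ z, Q n (x, z) ∂μ) atTop ∂μ := by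
          refine lintegral_mono_ae ?_
          filter_upwards [hpt] with x hx
          exact (lintegral_mono_ae hx).trans
            (lintegral_liminf_le fun n => (hQm n).comp measurable_prodMk_left)
      _ ≤ _ := lintegral_liminf_le fun n => (hQm n).lintegral_prod_right'
  have hmain : ∫⁻ x, ∫⁻ z, ‖F (w z) - F (w x)‖ₑ ∂μ ∂μ
      ≤ a * ∫⁻ x, ENNReal.ofReal (|deriv F (w x)| * ‖G x‖) := by
    refine le_of_forall_lt_imp_le_of_dense fun c hc => ?_
    refine le_lintegral_of_eventually_le_mollify hwi hGi
      ((contDiff_ramp b).continuous_deriv le_rfl) (abs_deriv_ramp_le hb) ha_top ?_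
    filter_upwards [hmol, eventually_lt_of_lt_liminf (hc.trans_le hfat)] with n h1 h2
    exact h2.le.trans h1
  -- the derivative of the truncation lives on the intermediate set
  have hupp : ∫⁻ x, ENNReal.ofReal (|deriv F (w x)| * ‖G x‖) ≤ ENNReal.ofReal (rampConst / b) *
      ∫⁻ x in cube y R, {x | 0 < f x ∧ f x < b}.indicator (fun x => ‖g x‖ₑ) x := by
    rw [← lintegral_indicator (measurableSet_cube y R),
      ← lintegral_const_mul' _ _ ENNReal.ofReal_ne_top]
    refine lintegral_mono fun x => ?_
    by_cases hx : x ∈ cube y ρ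
    · rw [indicator_of_mem (cube_mono hρR.le hx), hw, hG, indicator_of_mem hx, indicator_of_mem hx]
      by_cases hxf : 0 < f x ∧ f x < b
      · rw [indicator_of_mem (by exact hxf), ENNReal.ofReal_mul (abs_nonneg _), ofReal_norm]
        gcongr
        exact abs_deriv_ramp_le hb _
      · rw [deriv_ramp_eq_zero hb hxf]; simp
    · simp [hG, hx]
  refine (hlow.trans hmain).trans ((mul_le_mul' le_rfl hupp).trans (le_of_eq ?_))
  rw [ha, hd, isoConst, ← mul_assoc]
  congr 1
  have e1 : (2 : ℝ≥0∞) ^ N = ENNReal.ofReal (2 ^ N) := by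
    rw [ENNReal.ofReal_pow (by norm_num), ENNReal.ofReal_ofNat]
  have hL := rampConst_pos
  rw [e1, ← mul_assoc, ← ENNReal.ofReal_mul (by positivity), mul_right_comm,
    ← ENNReal.ofReal_mul (by positivity)]
  congr 2
  ring

/-! ### Time slices -/

variable {p γ : ℝ} {E : Set (SpaceTime N)} {u : SpaceTime N → ℝ}

lemma exists_mem_Ioo_of_ae {a b c d : ℝ} {P : ℝ → Prop}
    (h : ∀ᵐ t ∂(volume.restrict (Ioo a b)), P t) (hcd : c < d) (hsub : Ioo c d ⊆ Ioo a b) :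
    ∃ t ∈ Ioo c d, P t := by
  have h1 : ∀ᵐ t ∂(volume.restrict (Ioo c d)), P t := ae_restrict_of_ae_restrict_of_subset hsub h
  have h2 := h1.and (ae_restrict_mem measurableSet_Ioo)
  have : (ae (volume.restrict (Ioo c d))).NeBot := by
    rw [ae_neBot, Ne, Measure.restrict_eq_zero, Real.volume_Ioo]
    simpa using hcd
  obtain ⟨t, ht⟩ := h2.exists
  exact ⟨t, ht.2, ht.1⟩

lemma restrict_cyl (y : Space N) (s r τ : ℝ) :
    (volume.restrict (cyl y s r τ) : Measure (SpaceTime N))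
      = (volume.restrict (cube y r)).prod (volume.restrict (Ioo (s - τ) s)) := by
  rw [Measure.restrict_congr_set (Ioo_ae_eq_Ioc (μ := volume) (a := s - τ) (b := s)),
    Measure.prod_restrict, ← Measure.volume_eq_prod, cyl]

lemma ae_ae_of_ae_restrict_cyl {y : Space N} {s r τ : ℝ} {P : SpaceTime N → Prop}
    (h : ∀ᵐ z ∂(volume.restrict (cyl y s r τ)), P z) :
    ∀ᵐ t ∂(volume.restrict (Ioo (s - τ) s)), ∀ᵐ x ∂(volume.restrict (cube y r)), P (x, t) := by
  rw [restrict_cyl] at h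
  exact Measure.ae_ae_of_ae_prod (p := fun q : ℝ × Space N => P q.swap)
    (Measure.measurePreserving_swap.quasiMeasurePreserving.ae h)

lemma volume_cyl (y : Space N) (s r τ : ℝ) :
    volume (cyl y s r τ) = volume (cube y r) * ENNReal.ofReal τ := by
  rw [cyl, Measure.volume_eq_prod, Measure.prod_prod, Real.volume_Ioc, sub_sub_cancel]

lemma nullMeasurableSet_sep {K S : Set (Space N)} (hK : MeasurableSet K)
    (hS : NullMeasurableSet S (volume.restrict K)) : NullMeasurableSet {x ∈ K | x ∈ S} := by
  have := (nullMeasurableSet_restrict hK.nullMeasurableSet).1 hS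
  rwa [inter_comm] at this

lemma truncNeg_nonneg (k : ℝ) (z : SpaceTime N) : 0 ≤ truncNeg u k z := le_max_right _ _

lemma sliceEnergy_eq (hp : 0 < p) (k : ℝ) (y : Space N) (r t : ℝ) :
    sliceEnergy p u k y r t = eLpNorm (fun x => truncNeg u k (x, t)) (ENNReal.ofReal p)
      (volume.restrict (cube y r)) ^ p := by
  rw [eLpNorm_eq_lintegral_rpow_enorm_toReal (by simpa using hp) ENNReal.ofReal_ne_top,
    ENNReal.toReal_ofReal hp.le, ← ENNReal.rpow_mul, one_div, inv_mul_cancel₀ hp.ne',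
    ENNReal.rpow_one, sliceEnergy]
  refine lintegral_congr fun x => ?_
  rw [Real.enorm_of_nonneg (truncNeg_nonneg k _),
    ENNReal.ofReal_rpow_of_nonneg (truncNeg_nonneg k _) hp.le]

/-- A bound on the truncated energy of almost every slice passes to the final slice, by continuity
in `L^p`. -/
lemma sliceEnergy_le_of_essSup_le (hp : 1 ≤ p) {y : Space N} {s R T r k : ℝ} (hT : 0 < T)
    (hrR : r ≤ R) (hu : MemContLp p y s R T u) {B : ℝ≥0∞}
    (h : essSup (fun t => sliceEnergy p u k y r t) (volume.restrict (Ioo (s - T) s)) ≤ B) :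
    sliceEnergy p u k y r s ≤ B := by
  have hp0 : 0 < p := by linarith
  set μ := (volume : Measure (Space N)).restrict (cube y r) with hμ
  have hμR : μ ≤ volume.restrict (cube y R) := Measure.restrict_mono (cube_mono hrR) le_rfl
  have hae : ∀ᵐ t ∂(volume.restrict (Ioo (s - T) s)), sliceEnergy p u k y r t ≤ B :=
    (ENNReal.ae_le_essSup _).mono fun t ht => ht.trans h
  have hs : s ∈ Icc (s - T) s := ⟨by linarith, le_rfl⟩
  have hm : ∀ t ∈ Icc (s - T) s, AEStronglyMeasurable (fun x => truncNeg u k (x, t)) μ :=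
    fun t ht => (aestronglyMeasurable_const.sub ((hu.1 t ht).1.mono_measure hμR)).sup
      aestronglyMeasurable_const
  have htri : ∀ t ∈ Ioo (s - T) s, sliceEnergy p u k y r t ≤ B →
      eLpNorm (fun x => truncNeg u k (x, s)) (ENNReal.ofReal p) μ ≤ B ^ p⁻¹ +
        eLpNorm (fun x => u (x, t) - u (x, s)) (ENNReal.ofReal p)
          (volume.restrict (cube y R)) := by
    intro t ht hB
    have htI : t ∈ Icc (s - T) s := Ioo_subset_Icc_self ht
    have h1 : eLpNorm (fun x => truncNeg u k (x, t)) (ENNReal.ofReal p) μ ≤ B ^ p⁻¹ := by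
      rw [sliceEnergy_eq hp0] at hB
      rw [ENNReal.le_rpow_inv_iff hp0]
      exact hB
    have h2 : eLpNorm ((fun x => truncNeg u k (x, s)) - fun x => truncNeg u k (x, t))
        (ENNReal.ofReal p) μ ≤ eLpNorm (fun x => u (x, t) - u (x, s)) (ENNReal.ofReal p)
          (volume.restrict (cube y R)) := by
      refine (eLpNorm_mono fun x => ?_).trans (eLpNorm_mono_measure _ hμR)
      simp only [Pi.sub_apply, truncNeg, Real.norm_eq_abs]
      refine (abs_max_sub_max_le_abs _ _ _).trans (le_of_eq ?_)
      congr 1; ring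
    calc eLpNorm (fun x => truncNeg u k (x, s)) (ENNReal.ofReal p) μ
        = eLpNorm ((fun x => truncNeg u k (x, t)) + ((fun x => truncNeg u k (x, s))
            - fun x => truncNeg u k (x, t))) (ENNReal.ofReal p) μ := by
          rw [add_sub_cancel]
      _ ≤ _ := eLpNorm_add_le (hm t htI) ((hm s hs).sub (hm t htI))
          (by simpa using hp)
      _ ≤ _ := add_le_add h1 h2
  have hlim : Tendsto (fun t => B ^ p⁻¹ + eLpNorm (fun x => u (x, t) - u (x, s))
      (ENNReal.ofReal p) (volume.restrict (cube y R))) (𝓝[<] s) (𝓝 (B ^ p⁻¹)) := by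
    have h1 := (hu.2 s hs).mono_left (nhdsWithin_mono s (Ioo_subset_Icc_self))
    rw [nhdsWithin_Ioo_eq_nhdsLT (by linarith)] at h1
    simpa using h1.const_add (B ^ p⁻¹)
  have hfreq : ∃ᶠ t in 𝓝[<] s, eLpNorm (fun x => truncNeg u k (x, s)) (ENNReal.ofReal p) μ ≤
      B ^ p⁻¹ + eLpNorm (fun x => u (x, t) - u (x, s)) (ENNReal.ofReal p)
          (volume.restrict (cube y R)) := by
    intro hev
    obtain ⟨c, hc, hcs⟩ := (mem_nhdsLT_iff_exists_Ioo_subset' (show s - T < s by linarith)).1 hev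
    have hc' : c < s := hc
    obtain ⟨t, ht, htB⟩ := exists_mem_Ioo_of_ae hae (max_lt hc' (show s - T < s by linarith))
      (Ioo_subset_Ioo_left (le_max_right _ _))
    exact hcs ⟨(le_max_left _ _).trans_lt ht.1, ht.2⟩
      (htri t ⟨(le_max_right _ _).trans_lt ht.1, ht.2⟩ htB)
  have hfin := ge_of_tendsto_of_frequently hlim hfreq
  rw [sliceEnergy_eq hp0]
  rwa [ENNReal.le_rpow_inv_iff hp0] at hfin

/-- The times at which the slice of `u` is non-negative almost everywhere in `K`. -/
def NonnegSlice (u : SpaceTime N → ℝ) (K : Set (Space N)) (t : ℝ) : Prop :=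
  ∀ᵐ x ∂(volume.restrict K), 0 ≤ u (x, t)

lemma ae_nonnegSlice (hu : ∀ᵐ z ∂(volume.restrict E), 0 ≤ u z) {y : Space N} {r a b : ℝ}
    (hE : cube y r ×ˢ Ioc a b ⊆ E) :
    ∀ᵐ t ∂(volume.restrict (Ioo a b)), NonnegSlice u (cube y r) t := by
  have h := ae_ae_of_ae_restrict_cyl (y := y) (s := b) (r := r) (τ := b - a)
    (ae_restrict_of_ae_restrict_of_subset (by rwa [cyl, sub_sub_cancel]) hu)
  rwa [sub_sub_cancel] at h

lemma truncNeg_rpow_le (hp : 0 ≤ p) {k : ℝ} (hk : 0 ≤ k) {z : SpaceTime N} (hz : 0 ≤ u z) :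
    ENNReal.ofReal (truncNeg u k z ^ p) ≤ ENNReal.ofReal (k ^ p) :=
  ENNReal.ofReal_le_ofReal (Real.rpow_le_rpow (truncNeg_nonneg k z)
    (max_le (by linarith) hk) hp)

lemma cylEnergy_le (hp : 0 ≤ p) {k : ℝ} (hk : 0 ≤ k) {y : Space N} {s R T : ℝ}
    (hu : ∀ᵐ z ∂(volume.restrict E), 0 ≤ u z) (hE : cyl y s R T ⊆ E) :
    cylEnergy p u k y s R T ≤ ENNReal.ofReal (k ^ p) * (volume (cube y R) * ENNReal.ofReal T) := by
  rw [← volume_cyl y s, cylEnergy, ← setLIntegral_const]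
  refine lintegral_mono_ae ?_
  filter_upwards [ae_restrict_of_ae_restrict_of_subset hE hu] with z hz
  exact truncNeg_rpow_le hp hk hz

lemma sliceEnergy_le (hp : 0 < p) {k : ℝ} (hk : 0 ≤ k) {y : Space N} {R t : ℝ}
    (hu : NonnegSlice u (cube y R) t) :
    sliceEnergy p u k y R t
      ≤ ENNReal.ofReal (k ^ p) * volume {x ∈ cube y R | u (x, t) ≤ k} := by
  have h1 : sliceEnergy p u k y R t ≤ ∫⁻ x in cube y R,
      {x | u (x, t) ≤ k}.indicator (fun _ => ENNReal.ofReal (k ^ p)) x := by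
    refine lintegral_mono_ae ?_
    filter_upwards [hu] with x hx
    by_cases hxk : u (x, t) ≤ k
    · rw [indicator_of_mem (by exact hxk)]
      exact truncNeg_rpow_le hp.le hk hx
    · have : truncNeg u k (x, t) = 0 := max_eq_right (by linarith)
      rw [this, Real.zero_rpow hp.ne']; simp
  refine h1.trans ((lintegral_indicator_const_le _ _).trans (le_of_eq ?_))
  rw [Measure.restrict_apply' (measurableSet_cube y R), inter_comm]
  rfl

lemma le_sliceEnergy (hp : 0 < p) {k l : ℝ} (hl : l ≤ k) {y : Space N} {r t : ℝ}
    (hm : AEStronglyMeasurable (fun x => u (x, t)) (volume.restrict (cube y r))) :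
    ENNReal.ofReal ((k - l) ^ p) * volume {x ∈ cube y r | u (x, t) ≤ l}
      ≤ sliceEnergy p u k y r t := by
  have hm2 : AEMeasurable (fun x => ENNReal.ofReal (truncNeg u k (x, t) ^ p))
      (volume.restrict (cube y r)) :=
    (((hm.aemeasurable.const_sub k).max aemeasurable_const).pow_const p).ennreal_ofReal
  refine le_trans ?_ (mul_meas_ge_le_lintegral₀ hm2 (ENNReal.ofReal ((k - l) ^ p)))
  refine mul_le_mul' le_rfl ?_
  rw [Measure.restrict_apply' (measurableSet_cube y r)]
  refine measure_mono fun x hx => ⟨?_, hx.1⟩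
  refine ENNReal.ofReal_le_ofReal (Real.rpow_le_rpow (by linarith) ?_ hp.le)
  exact le_max_of_le_left (by linarith [hx.2])

lemma MemBMinus.memContLp' (hB : MemBMinus p γ E u) {y : Space N} {a b R ρ : ℝ} (hab : a < b)
    (hR : 0 < R) (hRρ : R < ρ) (hE : cube y ρ ×ˢ Icc a b ⊆ E) :
    CompactlyContained (cyl y b R (b - a)) E ∧ MemContLp p y b R (b - a) u := by
  have h : CompactlyContained (cyl y b R (b - a)) E := compactlyContained_cyl (by
    rw [sub_sub_cancel]; exact (prod_mono_left (closedCube_subset_cube hRρ)).trans hE)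
  exact ⟨h, hB.memContLp y b R (b - a) hR (by linarith) h⟩

/-! ### Propagation of measure information for a short time -/

/-- Growth of the sublevel sets between two times, from the energy inequality with initial data. -/
lemma volume_sublevel_le (hp : 1 < p) (hB : MemBMinus p γ E u)
    (hu : ∀ᵐ z ∂(volume.restrict E), 0 ≤ u z) {y : Space N} {a b r R ρ M ε : ℝ} (hab : a < b)
    (hr : 0 < r) (hrR : r < R) (hRρ : R < ρ) (hE : cube y ρ ×ˢ Icc a b ⊆ E) (hM : 0 < M)
    (hε1 : ε < 1) (ha : NonnegSlice u (cube y R) a) :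
    ENNReal.ofReal ((1 - ε) ^ p) * volume {x ∈ cube y r | u (x, b) ≤ ε * M}
      ≤ volume {x ∈ cube y R | u (x, a) ≤ M}
        + ENNReal.ofReal (γ / (R - r) ^ p) * (volume (cube y R) * ENNReal.ofReal (b - a)) := by
  obtain ⟨hcc, hcont⟩ := hB.memContLp' hab (hr.trans hrR) hRρ hE
  have hp0 : 0 < p := by linarith
  have hini := hB.initial y b R (b - a) (by linarith) hcc r M hr hrR
  have h1 := sliceEnergy_le_of_essSup_le hp.le (sub_pos.2 hab) hrR.le hcont hini
  rw [sub_sub_cancel] at h1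
  have hmeas : AEStronglyMeasurable (fun x => u (x, b)) (volume.restrict (cube y r)) :=
    (hcont.1 b ⟨by linarith, le_rfl⟩).1.mono_measure
      (Measure.restrict_mono (cube_mono hrR.le) le_rfl)
  have h2 := le_sliceEnergy hp0 (k := M) (l := ε * M) (by nlinarith) hmeas
  have h3 := sliceEnergy_le hp0 hM.le ha
  have h4 := cylEnergy_le hp0.le hM.le hu (subset_closure.trans hcc.2)
  have hMp : 0 < M ^ p := Real.rpow_pos_of_pos hM p
  have h5 : ENNReal.ofReal (M ^ p) * (ENNReal.ofReal ((1 - ε) ^ p) *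
      volume {x ∈ cube y r | u (x, b) ≤ ε * M}) ≤ ENNReal.ofReal (M ^ p) *
      (volume {x ∈ cube y R | u (x, a) ≤ M}
        + ENNReal.ofReal (γ / (R - r) ^ p) * (volume (cube y R) * ENNReal.ofReal (b - a))) := by
    calc _ = ENNReal.ofReal ((M - ε * M) ^ p) * volume {x ∈ cube y r | u (x, b) ≤ ε * M} := by
          rw [← mul_assoc, ← ENNReal.ofReal_mul hMp.le, ← Real.mul_rpow hM.le (by linarith)]
          congr 3; ring
      _ ≤ _ := h2.trans h1
      _ ≤ _ := add_le_add h3 (mul_le_mul' le_rfl h4)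
      _ = _ := by ring
  exact (ENNReal.mul_le_mul_iff_right (by simpa using hMp) ENNReal.ofReal_ne_top).1 h5

lemma volume_ne_top_of_subset_cube {y : Space N} {r : ℝ} {S : Set (Space N)} (h : S ⊆ cube y r) :
    volume S ≠ ∞ := ne_top_of_le_ne_top (volume_cube_ne_top y r) (measure_mono h)

lemma volume_cube_le_sublevel_add (y : Space N) (r l t : ℝ) :
    volume (cube y r)
      ≤ volume {x ∈ cube y r | u (x, t) ≤ l} + volume {x ∈ cube y r | l < u (x, t)} := by
  refine (measure_mono fun x hx => ?_).trans (measure_union_le _ _)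
  rcases le_or_gt (u (x, t)) l with h | h
  · exact Or.inl ⟨hx, h⟩
  · exact Or.inr ⟨hx, h⟩

/-- The admissible parameters of the short-time step: `σ` is the relative width of the layers cut
off from the cube, `δ` the relative waiting time, `ε` the loss of level. The bounds are arranged so
that a fraction `3α/4` at the start leaves a fraction `α/2` at the end:
`(1 - α/16) - (1 - 3α/4 + α/16) / (1 - ε) ^ p ≥ α/2`. -/
structure ShortTimeParams (N : ℕ) (p γ α σ δ ε : ℝ) : Prop where
  σ_pos : 0 < σ
  σ_lt : 3 * σ < 1
  δ_pos : 0 < δ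
  ε_pos : 0 < ε
  ε_lt : ε < 1
  cube_le : 1 - α / 16 ≤ (1 - 3 * σ) ^ N
  time_le : γ / (2 * σ) ^ p * δ ≤ α / 16
  level_le : 1 - 11 * α / 16 ≤ (1 - ε) ^ p * (1 - 9 * α / 16)

lemma exists_shortTimeParams (N : ℕ) {p γ α : ℝ} (hγ : 0 < γ) (hα0 : 0 < α) :
    ∃ σ δ ε, ShortTimeParams N p γ α σ δ ε := by
  have h1 : ∀ᶠ σ : ℝ in 𝓝[>] 0, 1 - α / 16 < (1 - 3 * σ) ^ N := by
    have : Tendsto (fun σ : ℝ => (1 - 3 * σ) ^ N) (𝓝 0) (𝓝 ((1 - 3 * 0) ^ N)) :=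
      Continuous.tendsto (by fun_prop) 0
    refine (this.mono_left nhdsWithin_le_nhds).eventually_const_lt ?_
    simp; linarith
  have h2 : ∀ᶠ σ : ℝ in 𝓝[>] 0, σ < 1 / 3 :=
    (tendsto_id.mono_left nhdsWithin_le_nhds).eventually_lt_const (by norm_num)
  have h3 : ∀ᶠ ε : ℝ in 𝓝[>] 0, 1 - 11 * α / 16 < (1 - ε) ^ p * (1 - 9 * α / 16) := by
    have : Tendsto (fun ε : ℝ => (1 - ε) ^ p * (1 - 9 * α / 16)) (𝓝 0)
        (𝓝 ((1 - 0) ^ p * (1 - 9 * α / 16))) := by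
      refine Tendsto.mul_const _ (Tendsto.rpow_const ?_ (Or.inl (by norm_num)))
      exact Continuous.tendsto (by fun_prop) 0
    refine (this.mono_left nhdsWithin_le_nhds).eventually_const_lt ?_
    simp; linarith
  have h4 : ∀ᶠ ε : ℝ in 𝓝[>] 0, ε < 1 :=
    (tendsto_id.mono_left nhdsWithin_le_nhds).eventually_lt_const (by norm_num)
  obtain ⟨σ, ⟨hσ1, hσ2⟩, hσ0⟩ := ((h1.and h2).and self_mem_nhdsWithin).exists
  obtain ⟨ε, ⟨hε1, hε2⟩, hε0⟩ := ((h3.and h4).and self_mem_nhdsWithin).exists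
  have hσ0' : 0 < σ := hσ0
  have hP : 0 < (2 * σ) ^ p := Real.rpow_pos_of_pos (by linarith) p
  exact ⟨σ, α / 16 * (2 * σ) ^ p / γ, ε, hσ0', by linarith, by positivity, hε0, hε2, hσ1.le,
    le_of_eq (by field_simp), hε1.le⟩

section Propagation

variable {α σ δ ε : ℝ}

lemma volume_superlevel_ge (hp : 1 < p) (hγ : 0 < γ) (hα0 : 0 < α)
    (hc : ShortTimeParams N p γ α σ δ ε) (hB : MemBMinus p γ E u)
    (hu : ∀ᵐ z ∂(volume.restrict E), 0 ≤ u z) {y : Space N} {a b ρ M : ℝ} (hρ : 0 < ρ)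
    (hM : 0 < M) (hab : a < b) (hbδ : b - a ≤ δ * ρ ^ p) (hE : cube y ρ ×ˢ Icc a b ⊆ E)
    (ha : NonnegSlice u (cube y ρ) a)
    (hmeas : ENNReal.ofReal (3 * α / 4) * volume (cube y ρ)
      ≤ volume {x ∈ cube y ρ | M < u (x, a)}) :
    ENNReal.ofReal (α / 2) * volume (cube y ρ)
      ≤ volume {x ∈ cube y ((1 - 3 * σ) * ρ) | ε * M < u (x, b)} := by
  have hσ := hc.σ_pos
  have hσ3 := hc.σ_lt
  set r := (1 - 3 * σ) * ρ with hr
  set R := (1 - σ) * ρ with hR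
  have hr0 : 0 < r := mul_pos (by linarith) hρ
  have hrR : r < R := mul_lt_mul_of_pos_right (by linarith) hρ
  have hRρ : R < ρ := by nlinarith
  have haR : NonnegSlice u (cube y R) a :=
    ae_restrict_of_ae_restrict_of_subset (cube_mono hRρ.le) ha
  have hmain := volume_sublevel_le hp hB hu hab hr0 hrR hRρ hE hM hc.ε_lt haR
  obtain ⟨-, hcont⟩ := hB.memContLp' hab (hr0.trans hrR) hRρ hE
  have ham : AEStronglyMeasurable (fun x => u (x, a)) (volume.restrict (cube y R)) :=
    (hcont.1 a ⟨by linarith, hab.le⟩).1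
  have hnull : NullMeasurableSet {x ∈ cube y R | u (x, a) ≤ M} := by
    have h1 : NullMeasurableSet {x | u (x, a) ≤ M} (volume.restrict (cube y R)) :=
      nullMeasurableSet_le ham.aemeasurable aemeasurable_const
    exact nullMeasurableSet_sep (measurableSet_cube y R) h1
  have hY : volume {x ∈ cube y R | u (x, a) ≤ M}
      + ENNReal.ofReal (3 * α / 4) * volume (cube y ρ) ≤ volume (cube y ρ) := by
    rw [← measure_inter_add_sdiff₀ (cube y ρ) hnull]
    refine add_le_add (measure_mono fun x hx => ⟨cube_mono hRρ.le hx.1, hx⟩) ?_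
    rw [measure_inter_add_sdiff₀ (cube y ρ) hnull]
    exact hmeas.trans (measure_mono fun x hx => ⟨hx.1, fun h => (h.2.trans_lt hx.2).false⟩)
  have hVR : volume (cube y R) ≤ volume (cube y ρ) := measure_mono (cube_mono hRρ.le)
  have hVr : volume (cube y r) = ENNReal.ofReal ((1 - 3 * σ) ^ N) * volume (cube y ρ) :=
    volume_cube_mul y (by linarith)
  have hsplit := volume_cube_le_sublevel_add (u := u) y r (ε * M) b
  rw [hVr] at hsplit
  -- everything is finite, so the estimates can be combined in `ℝ`
  have hX_top : volume {x ∈ cube y r | u (x, b) ≤ ε * M} ≠ ∞ :=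
    volume_ne_top_of_subset_cube fun x hx => hx.1
  have hZ_top : volume {x ∈ cube y r | ε * M < u (x, b)} ≠ ∞ :=
    volume_ne_top_of_subset_cube fun x hx => hx.1
  have hY_top : volume {x ∈ cube y R | u (x, a) ≤ M} ≠ ∞ :=
    volume_ne_top_of_subset_cube fun x hx => hx.1
  have hV_top := volume_cube_ne_top y ρ
  have hV0 : 0 < (volume (cube y ρ)).toReal :=
    ENNReal.toReal_pos (volume_cube_ne_zero y hρ) hV_top
  have hmain' := hmain.trans (add_le_add_right (mul_le_mul' le_rfl
    (mul_le_mul' hVR (ENNReal.ofReal_le_ofReal hbδ))) _)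
  generalize volume (cube y ρ) = V at *
  generalize volume {x ∈ cube y r | u (x, b) ≤ ε * M} = X at *
  generalize volume {x ∈ cube y r | ε * M < u (x, b)} = Z at *
  generalize volume {x ∈ cube y R | u (x, a) ≤ M} = Y at *
  lift V to NNReal using hV_top
  lift X to NNReal using hX_top
  lift Y to NNReal using hY_top
  lift Z to NNReal using hZ_top
  have hRr : 0 < R - r := sub_pos.2 hrR
  have hρp : 0 < ρ ^ p := Real.rpow_pos_of_pos hρ p
  have hε' : 0 < 1 - ε := by linarith [hc.ε_lt]
  have hεp : 0 < (1 - ε) ^ p := Real.rpow_pos_of_pos hε' p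
  have hδ := hc.δ_pos
  have hK : 0 ≤ γ / (R - r) ^ p := by positivity
  have hq : 0 ≤ (1 - 3 * σ) ^ N := pow_nonneg (by linarith) N
  have e1 := ENNReal.toReal_mono (by finiteness) hmain'
  have e2 := ENNReal.toReal_mono (by finiteness) hY
  have e3 := ENNReal.toReal_mono (by finiteness) hsplit
  rw [ENNReal.toReal_add (by finiteness) (by finiteness)] at e1 e2 e3
  simp only [ENNReal.toReal_mul, ENNReal.toReal_ofReal hK, ENNReal.toReal_ofReal hεp.le,
    ENNReal.toReal_ofReal hq, ENNReal.coe_toReal,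
    ENNReal.toReal_ofReal (show 0 ≤ 3 * α / 4 by positivity),
    ENNReal.toReal_ofReal (show 0 ≤ δ * ρ ^ p by positivity)] at e1 e2 e3 hV0
  have hscale : γ / (R - r) ^ p * (V * (δ * ρ ^ p)) ≤ α / 16 * V := by
    have h1 : R - r = 2 * σ * ρ := by rw [hR, hr]; ring
    have h2 : γ / (R - r) ^ p * (V * (δ * ρ ^ p)) = (γ / (2 * σ) ^ p * δ) * V := by
      rw [h1, Real.mul_rpow (by positivity) hρ.le]
      field_simp
    rw [h2]
    exact mul_le_mul_of_nonneg_right hc.time_le hV0.le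
  have hX : (X : ℝ) ≤ (1 - 9 * α / 16) * V := by
    have h1 : (1 - ε) ^ p * X ≤ (1 - ε) ^ p * ((1 - 9 * α / 16) * V) := by
      calc (1 - ε) ^ p * (X : ℝ) ≤ (1 - 11 * α / 16) * V := by linarith
        _ ≤ ((1 - ε) ^ p * (1 - 9 * α / 16)) * V :=
          mul_le_mul_of_nonneg_right hc.level_le hV0.le
        _ = _ := by ring
    exact le_of_mul_le_mul_left h1 hεp
  have hfin : α / 2 * V ≤ (Z : ℝ) := by
    have := mul_le_mul_of_nonneg_right hc.cube_le hV0.le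
    linarith
  have : ENNReal.ofReal (α / 2) * V = ENNReal.ofReal (α / 2 * V) := by
    rw [ENNReal.ofReal_mul (by positivity), ENNReal.ofReal_coe_nnreal]
  rw [this, ← ENNReal.ofReal_coe_nnreal (p := Z)]
  exact ENNReal.ofReal_le_ofReal hfin

end Propagation

/-! ### Shrinking of the sublevel sets -/

/-- A form of Young's inequality: `x ≤ L + L ^ (1 - p) x ^ p`. -/
lemma le_add_rpow (hp : 1 < p) {L x : ℝ} (hL : 0 < L) (hx : 0 ≤ x) :
    x ≤ L + L ^ (1 - p) * x ^ p := by
  rcases le_or_gt x L with h | h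
  · have : 0 ≤ L ^ (1 - p) * x ^ p := by positivity
    linarith
  · have hx' : 0 < x := hL.trans h
    have h1 : x ^ (1 - p) ≤ L ^ (1 - p) :=
      Real.rpow_le_rpow_of_nonpos hL h.le (by linarith)
    have h2 : x = x ^ (1 - p) * x ^ p := by
      rw [← Real.rpow_add hx']; simp
    have h3 : x ^ (1 - p) * x ^ p ≤ L ^ (1 - p) * x ^ p := by gcongr
    linarith

/-- The part of a cylinder where `u` lies strictly between `k / 2` and `k`. -/
def band (u : SpaceTime N → ℝ) (k : ℝ) (y : Space N) (s r τ : ℝ) : Set (SpaceTime N) :=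
  {z ∈ cyl y s r τ | k / 2 < u z ∧ u z < k}

lemma nullMeasurableSet_band {y : Space N} {s r τ : ℝ} (k : ℝ)
    (hu : AEMeasurable u (volume.restrict (cyl y s r τ))) :
    NullMeasurableSet (band u k y s r τ) := by
  have h1 : NullMeasurableSet {z | k / 2 < u z ∧ u z < k} (volume.restrict (cyl y s r τ)) :=
    (nullMeasurableSet_lt aemeasurable_const hu).inter (nullMeasurableSet_lt hu aemeasurable_const)
  have := (nullMeasurableSet_restrict (measurableSet_cyl y s r τ).nullMeasurableSet).1 h1
  rwa [inter_comm] at this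

/-- If at almost every time both `{u ≥ k}` and `{u ≤ k / 2}` occupy a definite portion of the cube,
then the isoperimetric inequality and the energy inequality bound the band between the levels `k / 2`
and `k` from below. The parameter `L` comes from Young's inequality. -/
lemma volume_band_ge (hp : 1 < p) (hγ : 0 < γ) (hB : MemBMinus p γ E u)
    (hu : ∀ᵐ z ∂(volume.restrict E), 0 ≤ u z) {y : Space N} {s θ r r₂ R ρ k L : ℝ}
    (hr : 0 < r) (hr₂ : r < r₂) (hR : r₂ < R) (hρ : R < ρ) (hθ : 0 < θ) (hk : 0 < k) (hL : 0 < L)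
    (hE : cube y ρ ×ˢ Icc (s - 2 * θ) s ⊆ E) {c₁ c₂ : ℝ≥0∞}
    (hc : ∀ᵐ t ∂(volume.restrict (Ioo (s - θ) s)), c₁ ≤ volume {x ∈ cube y r | k ≤ u (x, t)} ∧
      c₂ ≤ volume {x ∈ cube y r | u (x, t) ≤ k / 2}) :
    c₂ * c₁ * ENNReal.ofReal θ ≤ ENNReal.ofReal (2 * isoConst N) * volume (cube y ρ) *
      (ENNReal.ofReal L * volume (band u k y s r₂ θ) +
        ENNReal.ofReal (L ^ (1 - p) * (2 * ρ ^ p * (γ / (R - r₂) ^ p + γ / θ)) * θ)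
          * volume (cube y ρ)) := by
  have hr₂0 : 0 < r₂ := hr.trans hr₂
  have hρ0 : 0 < ρ := by linarith
  have hp0 : 0 < p := by linarith
  have hcc : CompactlyContained (cyl y s R (2 * θ)) E :=
    compactlyContained_cyl ((prod_mono_left (closedCube_subset_cube hρ)).trans hE)
  obtain ⟨G, hG, hGe⟩ := hB.memAMinus.energy y s R (2 * θ) hcc r₂ θ k hr₂0 hR hθ (by linarith)
  have hsub : cyl y s r₂ θ ⊆ E :=
    (Set.prod_mono (cube_mono hR.le) (Ioc_subset_Ioc_left (by linarith))).trans
      (subset_closure.trans hcc.2)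
  have hum : AEMeasurable u (volume.restrict (cyl y s r₂ θ)) :=
    hB.memAMinus.aemeasurable.mono_measure (Measure.restrict_mono hsub le_rfl)
  set S : Set (SpaceTime N) := {z | k / 2 < u z ∧ u z < k} with hS
  have hSm : NullMeasurableSet S (volume.restrict (cyl y s r₂ θ)) :=
    (nullMeasurableSet_lt aemeasurable_const hum).inter (nullMeasurableSet_lt hum aemeasurable_const)
  have hI : AEMeasurable (S.indicator fun z => ‖G z‖ₑ) (volume.restrict (cyl y s r₂ θ)) :=
    hG.1.enorm.indicator₀ hSm
  set C₁ : ℝ≥0∞ := ENNReal.ofReal (isoConst N * r / (k / 2)) * volume (cube y r) with hC₁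
  have hC₁top : C₁ ≠ ∞ := ENNReal.mul_ne_top ENNReal.ofReal_ne_top (volume_cube_ne_top y r)
  -- integrate the isoperimetric inequality in time
  have hslice : c₂ * c₁ * ENNReal.ofReal θ
      ≤ C₁ * ∫⁻ z in cyl y s r₂ θ, S.indicator (fun z => ‖G z‖ₑ) z := by
    have h1 : ∀ᵐ t ∂(volume.restrict (Ioo (s - θ) s)), c₂ * c₁ ≤
        C₁ * ∫⁻ x in cube y r₂, S.indicator (fun z => ‖G z‖ₑ) (x, t) := by
      filter_upwards [hc, hG.2] with t ht hGt
      have hiso := volume_mul_volume_le hr hr₂ hGt (half_pos hk)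
      have e1 : {x ∈ cube y r | k / 2 ≤ truncNeg u k (x, t)}
          = {x ∈ cube y r | u (x, t) ≤ k / 2} := by
        ext x
        refine and_congr_right fun _ => ?_
        rw [truncNeg, le_max_iff]
        constructor
        · rintro (h | h) <;> linarith
        · intro h; left; linarith
      have e2 : {x ∈ cube y r | truncNeg u k (x, t) ≤ 0} = {x ∈ cube y r | k ≤ u (x, t)} := by
        ext x
        refine and_congr_right fun _ => ?_
        rw [truncNeg, max_le_iff]
        constructor
        · rintro ⟨h, -⟩; linarith
        · intro h; exact ⟨by linarith, le_rfl⟩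
      have e3 : {x | 0 < truncNeg u k (x, t) ∧ truncNeg u k (x, t) < k / 2}
          = {x | (x, t) ∈ S} := by
        ext x
        change (0 < max _ _ ∧ max _ _ < k / 2) ↔ (k / 2 < u (x, t) ∧ u (x, t) < k)
        rw [lt_max_iff, max_lt_iff]
        constructor
        · rintro ⟨h | h, h2, -⟩
          · exact ⟨by linarith, by linarith⟩
          · exact absurd h (lt_irrefl _)
        · rintro ⟨h, h2⟩; exact ⟨Or.inl (by linarith), by linarith, by linarith⟩
      rw [e1, e2, e3] at hiso
      exact (mul_le_mul' ht.2 ht.1).trans hiso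
    have h2 : ∫⁻ z in cyl y s r₂ θ, S.indicator (fun z => ‖G z‖ₑ) z
        = ∫⁻ t in Ioo (s - θ) s, ∫⁻ x in cube y r₂, S.indicator (fun z => ‖G z‖ₑ) (x, t) := by
      rw [restrict_cyl] at hI ⊢
      exact lintegral_prod_symm _ hI
    rw [h2, ← lintegral_const_mul' _ _ hC₁top]
    calc c₂ * c₁ * ENNReal.ofReal θ = ∫⁻ _t in Ioo (s - θ) s, c₂ * c₁ := by
          rw [setLIntegral_const, Real.volume_Ioo, sub_sub_cancel]
      _ ≤ _ := lintegral_mono_ae h1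
  -- Young's inequality and the energy inequality
  have hkρ : 0 < k / ρ := by positivity
  set D : ℝ := γ / (R - r₂) ^ p + γ / θ with hD
  have hRr : 0 < R - r₂ := sub_pos.2 hR
  have hD0 : 0 < D := by positivity
  have hLp : 0 < L ^ (1 - p) := Real.rpow_pos_of_pos hL _
  have hρk : 0 < (ρ / k) ^ p := Real.rpow_pos_of_pos (by positivity) _
  have hyoung : ∫⁻ z in cyl y s r₂ θ, S.indicator (fun z => ‖G z‖ₑ) z
      ≤ ENNReal.ofReal (k / ρ) * (ENNReal.ofReal L * volume (band u k y s r₂ θ) +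
        ENNReal.ofReal (L ^ (1 - p) * (ρ / k) ^ p) *
          ∫⁻ z in cyl y s r₂ θ, ENNReal.ofReal (‖G z‖ ^ p)) := by
    have hpt : ∀ z, S.indicator (fun z => ‖G z‖ₑ) z ≤ ENNReal.ofReal (k / ρ) *
        (S.indicator (fun _ => ENNReal.ofReal L) z +
          ENNReal.ofReal (L ^ (1 - p) * (ρ / k) ^ p) * ENNReal.ofReal (‖G z‖ ^ p)) := fun z => by
      by_cases hz : z ∈ S
      · rw [indicator_of_mem hz, indicator_of_mem hz, ← ofReal_norm,
          ← ENNReal.ofReal_mul (by positivity), ← ENNReal.ofReal_add hL.le (by positivity),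
          ← ENNReal.ofReal_mul hkρ.le]
        refine ENNReal.ofReal_le_ofReal ?_
        have h1 := le_add_rpow hp hL (x := ρ / k * ‖G z‖) (by positivity)
        rw [Real.mul_rpow (by positivity) (norm_nonneg _)] at h1
        calc ‖G z‖ = k / ρ * (ρ / k * ‖G z‖) := by field_simp
          _ ≤ k / ρ * (L + L ^ (1 - p) * ((ρ / k) ^ p * ‖G z‖ ^ p)) := by gcongr
          _ = _ := by ring
      · rw [indicator_of_notMem hz]; exact zero_le
    refine (lintegral_mono hpt).trans ?_
    rw [lintegral_const_mul' _ _ ENNReal.ofReal_ne_top]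
    refine mul_le_mul' le_rfl ?_
    rw [lintegral_add_left' (aemeasurable_const.indicator₀ hSm),
      lintegral_const_mul' _ _ ENNReal.ofReal_ne_top]
    refine add_le_add_left ?_ _
    refine (lintegral_indicator_const_le _ _).trans (le_of_eq ?_)
    rw [Measure.restrict_apply' (measurableSet_cyl y s r₂ θ), inter_comm]
    rfl
  have hen : ∫⁻ z in cyl y s r₂ θ, ENNReal.ofReal (‖G z‖ ^ p)
      ≤ ENNReal.ofReal D * (ENNReal.ofReal (k ^ p) *
        (volume (cube y ρ) * ENNReal.ofReal (2 * θ))) := by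
    refine (le_add_self.trans hGe).trans ?_
    rw [show 2 * θ - θ = θ by ring]
    refine mul_le_mul' le_rfl ((cylEnergy_le hp0.le hk.le hu (subset_closure.trans hcc.2)).trans ?_)
    gcongr
    exact cube_mono hρ.le
  have hI0 := isoConst_pos N
  refine hslice.trans ?_
  calc C₁ * ∫⁻ z in cyl y s r₂ θ, S.indicator (fun z => ‖G z‖ₑ) z
      ≤ (ENNReal.ofReal (isoConst N * ρ / (k / 2)) * volume (cube y ρ)) *
        (ENNReal.ofReal (k / ρ) * (ENNReal.ofReal L * volume (band u k y s r₂ θ) +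
        ENNReal.ofReal (L ^ (1 - p) * (ρ / k) ^ p) * (ENNReal.ofReal D *
          (ENNReal.ofReal (k ^ p) * (volume (cube y ρ) * ENNReal.ofReal (2 * θ)))))) := by
        rw [hC₁]
        refine mul_le_mul' (mul_le_mul' (ENNReal.ofReal_le_ofReal ?_)
          (measure_mono (cube_mono (by linarith)))) (hyoung.trans ?_)
        · gcongr; linarith
        · gcongr
    _ = (ENNReal.ofReal (isoConst N * ρ / (k / 2)) * ENNReal.ofReal (k / ρ)) * volume (cube y ρ) *
        (ENNReal.ofReal L * volume (band u k y s r₂ θ) +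
        (ENNReal.ofReal (L ^ (1 - p) * (ρ / k) ^ p) * (ENNReal.ofReal D *
          (ENNReal.ofReal (k ^ p) * ENNReal.ofReal (2 * θ)))) * volume (cube y ρ)) := by ring
    _ = _ := by
        rw [← ENNReal.ofReal_mul (by positivity), ← ENNReal.ofReal_mul (by positivity),
          ← ENNReal.ofReal_mul (by positivity), ← ENNReal.ofReal_mul (by positivity)]
        have e1 : isoConst N * ρ / (k / 2) * (k / ρ) = 2 * isoConst N := by field_simp
        have e2 : L ^ (1 - p) * (ρ / k) ^ p * (D * (k ^ p * (2 * θ)))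
            = L ^ (1 - p) * (2 * ρ ^ p * D) * θ := by
          rw [Real.div_rpow hρ0.le hk.le]
          field_simp
        rw [e1, e2]

/-! ### Recovering the initial measure information at a later time -/

/-- The bands between consecutive dyadic levels are disjoint, so their measures add up to at most
the measure of the cylinder. -/
lemma sum_volume_band_le {y : Space N} {s r τ k : ℝ} (hk : 0 < k)
    (hu : AEMeasurable u (volume.restrict (cyl y s r τ))) (n : ℕ) :
    ∑ j ∈ Finset.range n, volume (band u (k / 2 ^ j) y s r τ) ≤ volume (cyl y s r τ) := by
  rw [← measure_biUnion_finset₀]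
  · exact measure_mono (iUnion₂_subset fun j _ z hz => hz.1)
  · have key : ∀ i j : ℕ, i < j →
        Disjoint (band u (k / 2 ^ i) y s r τ) (band u (k / 2 ^ j) y s r τ) := by
      intro i j hij
      refine Set.disjoint_left.2 fun z hi hj => ?_
      have h1 := hi.2.1
      have h2 := hj.2.2
      have h3 : k / 2 ^ j ≤ k / 2 ^ i / 2 := by
        rw [div_div, ← pow_succ]
        gcongr
        · norm_num
        · exact hij
      linarith
    intro i _ j _ hij
    rcases lt_or_gt_of_ne hij with h | h
    · exact (key i j h).aedisjoint
    · exact (key j i h).symm.aedisjoint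
  · exact fun j _ => nullMeasurableSet_band _ hu

section Restart

variable {α σ δ ε : ℝ}

/-- After the short-time step, at some time in the second half of the waiting interval the sublevel
sets of a much smaller level `η M` are so small that the initial measure information is recovered
with `M` replaced by `η M`. -/
lemma exists_restart_level (hp : 1 < p) (hγ : 0 < γ) (hα0 : 0 < α) (hα1 : α < 1)
    (hc : ShortTimeParams N p γ α σ δ ε) :
    ∃ η : ℝ, 0 < η ∧ η ≤ 1 ∧ ∀ (E : Set (SpaceTime N)) (u : SpaceTime N → ℝ),
      MemBMinus p γ E u → (∀ᵐ z ∂(volume.restrict E), 0 ≤ u z) →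
      ∀ (y : Space N) (a ρ M : ℝ), 0 < ρ → 0 < M → cube y ρ ×ˢ Icc a (a + δ * ρ ^ p) ⊆ E →
      NonnegSlice u (cube y ρ) a →
      ENNReal.ofReal (3 * α / 4) * volume (cube y ρ) ≤ volume {x ∈ cube y ρ | M < u (x, a)} →
      ∃ t ∈ Ioo (a + δ * ρ ^ p / 2) (a + δ * ρ ^ p), NonnegSlice u (cube y ρ) t ∧
        ENNReal.ofReal (3 * α / 4) * volume (cube y ρ)
          ≤ volume {x ∈ cube y ρ | η * M < u (x, t)} := by
  have hσ := hc.σ_pos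
  have hσ3 := hc.σ_lt
  have hδ := hc.δ_pos
  have hε := hc.ε_pos
  have hI := isoConst_pos N
  -- the portion of the cube left below `η M` if `u > η M` on less than `3α/4` of it
  set ν : ℝ := 1 - 13 * α / 16 with hν
  have hν0 : 0 < ν := by linarith
  set D : ℝ := 2 * (γ / σ ^ p + 2 * γ / δ) with hD
  have hσp : 0 < σ ^ p := Real.rpow_pos_of_pos hσ p
  have hD0 : 0 < D := by positivity
  obtain ⟨L, hL0, hL⟩ : ∃ L : ℝ, 0 < L ∧ 2 * isoConst N * (L ^ (1 - p) * D) ≤ ν * α / 4 := by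
    have h1 : Tendsto (fun L : ℝ => 2 * isoConst N * (L ^ (-(p - 1)) * D)) atTop (𝓝 0) := by
      simpa using ((tendsto_rpow_neg_atTop (sub_pos.2 hp)).mul_const D).const_mul (2 * isoConst N)
    obtain ⟨L, hL, hL0⟩ := ((h1.eventually_le_const (show 0 < ν * α / 4 by positivity)).and
      (eventually_gt_atTop 0)).exists
    exact ⟨L, hL0, by simpa using hL⟩
  -- each band will fill at least a fraction `ν α / (8 I L)` of the cylinder, `I = isoConst N`, so
  -- there cannot be `n` disjoint ones
  obtain ⟨n, hn⟩ := exists_nat_gt (8 * isoConst N * L / (ν * α))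
  refine ⟨min (ε / 2 ^ n) 1, by positivity, min_le_right _ _, ?_⟩
  set η := min (ε / 2 ^ n) 1 with hη
  intro E u hB hu y a ρ M hρ hM hE ha hmeas
  by_contra hcon
  push Not at hcon
  have hρp : 0 < ρ ^ p := Real.rpow_pos_of_pos hρ p
  set θ := δ * ρ ^ p / 2 with hθ
  have hθ0 : 0 < θ := by positivity
  set b := a + δ * ρ ^ p with hb
  have hba : b - 2 * θ = a := by rw [hb, hθ]; ring
  have hba' : a + θ = b - θ := by linarith
  rw [hba'] at hcon
  set r := (1 - 3 * σ) * ρ with hr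
  set r₂ := (1 - 2 * σ) * ρ with hr₂
  set R := (1 - σ) * ρ with hR
  have hr0 : 0 < r := mul_pos (by linarith) hρ
  have hrr : r < r₂ := mul_lt_mul_of_pos_right (by linarith) hρ
  have hrR : r₂ < R := mul_lt_mul_of_pos_right (by linarith) hρ
  have hRρ : R < ρ := by nlinarith
  have hVr : volume (cube y r) = ENNReal.ofReal ((1 - 3 * σ) ^ N) * volume (cube y ρ) :=
    volume_cube_mul y (by linarith)
  -- the slices: a definite portion above `ε M`, a definite portion below `η M`
  have habove : ∀ t ∈ Ioo (b - θ) b, ENNReal.ofReal (α / 2) * volume (cube y ρ)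
      ≤ volume {x ∈ cube y r | ε * M < u (x, t)} := fun t ht => by
    have hta : a < t := by linarith [ht.1]
    exact volume_superlevel_ge hp hγ hα0 hc hB hu hρ hM hta (by linarith [ht.2])
      ((Set.prod_mono_right (Icc_subset_Icc_right ht.2.le)).trans hE) ha hmeas
  have hbelow : ∀ t ∈ Ioo (b - θ) b, NonnegSlice u (cube y ρ) t →
      ENNReal.ofReal ν * volume (cube y ρ) ≤ volume {x ∈ cube y r | u (x, t) ≤ η * M} := by
    intro t ht hnn
    have h1 := (hcon t ht hnn).le
    have h2 : volume {x ∈ cube y r | η * M < u (x, t)}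
        ≤ volume {x ∈ cube y ρ | η * M < u (x, t)} :=
      measure_mono fun x hx => ⟨cube_mono (by linarith) hx.1, hx.2⟩
    have h3 := volume_cube_le_sublevel_add (u := u) y r (η * M) t
    have h4 : ENNReal.ofReal (ν + 3 * α / 4) * volume (cube y ρ) ≤ volume (cube y r) := by
      rw [hVr]
      refine mul_le_mul' (ENNReal.ofReal_le_ofReal ?_) le_rfl
      have := hc.cube_le
      rw [hν]; linarith
    rw [ENNReal.ofReal_add hν0.le (by positivity), add_mul] at h4
    have hfin : ENNReal.ofReal (3 * α / 4) * volume (cube y ρ) ≠ ∞ :=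
      ENNReal.mul_ne_top ENNReal.ofReal_ne_top (volume_cube_ne_top y ρ)
    exact (ENNReal.add_le_add_iff_right hfin).1
      (h4.trans (h3.trans (by gcongr; exact h2.trans h1)))
  have hIoc : Ioc (b - θ) b ⊆ Icc a b := fun t ht => ⟨by linarith [ht.1], ht.2⟩
  have hnonneg : ∀ᵐ t ∂(volume.restrict (Ioo (b - θ) b)), NonnegSlice u (cube y ρ) t :=
    ae_nonnegSlice hu ((Set.prod_mono_right hIoc).trans hE)
  -- lower bound for the measure of each band
  set V := volume (cube y ρ) with hV
  have hV_top : V ≠ ∞ := volume_cube_ne_top y ρ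
  have hV0 : 0 < V.toReal := ENNReal.toReal_pos (volume_cube_ne_zero y hρ) hV_top
  have hcyl : volume (cyl y b r₂ θ) ≤ V * ENNReal.ofReal θ := by
    rw [volume_cyl]
    gcongr
    exact measure_mono (cube_mono (by linarith))
  have hcyl_top : volume (cyl y b r₂ θ) ≠ ∞ :=
    ne_top_of_le_ne_top (ENNReal.mul_ne_top hV_top ENNReal.ofReal_ne_top) hcyl
  have hband_top : ∀ k, volume (band u k y b r₂ θ) ≠ ∞ := fun k =>
    ne_top_of_le_ne_top hcyl_top (measure_mono fun z hz => hz.1)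
  have hband : ∀ j ∈ Finset.range n, ν * α / 4 * (V.toReal * θ)
      ≤ 2 * isoConst N * L * (volume (band u (ε * M / 2 ^ j) y b r₂ θ)).toReal := by
    intro j hj
    have hj' : j + 1 ≤ n := Finset.mem_range.1 hj
    set k := ε * M / 2 ^ j with hk
    have hk0 : 0 < k := by positivity
    have hk1 : k ≤ ε * M := div_le_self (by positivity) (one_le_pow₀ (by norm_num))
    have hk2 : η * M ≤ k / 2 := by
      calc η * M ≤ ε / 2 ^ n * M := by gcongr; exact min_le_left _ _
        _ ≤ ε / 2 ^ (j + 1) * M := by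
          gcongr
          norm_num
        _ = k / 2 := by rw [hk, pow_succ]; field_simp
    have h := volume_band_ge hp hγ hB hu (y := y) (s := b) (k := k) (c₁ := ENNReal.ofReal (α / 2) * V)
      (c₂ := ENNReal.ofReal ν * V) hr0 hrr hrR hRρ hθ0 hk0 hL0 (by rwa [hba]) (by
        filter_upwards [hnonneg, ae_restrict_mem measurableSet_Ioo] with t ht htI
        exact ⟨(habove t htI).trans (measure_mono fun x hx => ⟨hx.1, hk1.trans hx.2.le⟩),
          (hbelow t htI ht).trans (measure_mono fun x hx => ⟨hx.1, le_trans hx.2 hk2⟩)⟩)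
    have hconst : L ^ (1 - p) * (2 * ρ ^ p * (γ / (R - r₂) ^ p + γ / θ)) * θ
        = L ^ (1 - p) * D * θ := by
      have h1 : R - r₂ = σ * ρ := by rw [hR, hr₂]; ring
      rw [h1, Real.mul_rpow hσ.le hρ.le, hD, hθ]
      field_simp
    rw [hconst, ← hV] at h
    have hLp : 0 < L ^ (1 - p) := Real.rpow_pos_of_pos hL0 _
    have hbt := hband_top k
    have e := ENNReal.toReal_mono (by finiteness) h
    rw [ENNReal.toReal_mul (a := ENNReal.ofReal (2 * isoConst N) * V),
      ENNReal.toReal_add (by finiteness) (by finiteness)] at e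
    simp only [ENNReal.toReal_mul, ENNReal.toReal_ofReal hν0.le,
      ENNReal.toReal_ofReal (show 0 ≤ α / 2 by positivity), ENNReal.toReal_ofReal hθ0.le,
      ENNReal.toReal_ofReal (show 0 ≤ 2 * isoConst N by positivity), ENNReal.toReal_ofReal hL0.le,
      ENNReal.toReal_ofReal (show 0 ≤ L ^ (1 - p) * D * θ by positivity)] at e
    set v := V.toReal
    set B := (volume (band u k y b r₂ θ)).toReal
    have e1 : v * (ν * (α / 2) * (v * θ))
        ≤ v * (2 * isoConst N * L * B + 2 * isoConst N * (L ^ (1 - p) * D) * (v * θ)) := by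
      linarith
    have e2 := le_of_mul_le_mul_left e1 hV0
    have e3 := mul_le_mul_of_nonneg_right hL (show 0 ≤ v * θ by positivity)
    linarith
  -- too many disjoint bands
  have hsub : cyl y b r₂ θ ⊆ E :=
    (Set.prod_mono (cube_mono (by linarith)) hIoc).trans hE
  have hum : AEMeasurable u (volume.restrict (cyl y b r₂ θ)) :=
    hB.memAMinus.aemeasurable.mono_measure (Measure.restrict_mono hsub le_rfl)
  have hsum := (sum_volume_band_le (mul_pos hε hM) hum n).trans hcyl
  have hsum' := ENNReal.toReal_mono (by finiteness) hsum
  rw [ENNReal.toReal_sum fun j _ => hband_top _, ENNReal.toReal_mul,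
    ENNReal.toReal_ofReal hθ0.le] at hsum'
  have htot := Finset.sum_le_sum hband
  rw [Finset.sum_const, Finset.card_range, nsmul_eq_mul, ← Finset.mul_sum] at htot
  have hvθ : 0 < V.toReal * θ := by positivity
  have h1 : n * (ν * α / 4) * (V.toReal * θ) ≤ 2 * isoConst N * L * (V.toReal * θ) := by
    calc n * (ν * α / 4) * (V.toReal * θ) = n * (ν * α / 4 * (V.toReal * θ)) := by ring
      _ ≤ _ := htot
      _ ≤ _ := mul_le_mul_of_nonneg_left hsum' (by positivity)
  have h2 := le_of_mul_le_mul_right h1 hvθ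
  rw [div_lt_iff₀ (by positivity)] at hn
  linarith

end Restart

/-! ### The initial time -/

/-- Superlevel sets are stable under `L^p` continuity in time. -/
lemma tendsto_volume_drop (hp : 1 < p) {x₀ : Space N} {s r h M : ℝ} (hh : 0 < h) (hM : 0 < M)
    (hu : MemContLp p x₀ (s + h) r h u) :
    Tendsto (fun t => volume {x ∈ cube x₀ r | M < u (x, s) ∧ u (x, t) ≤ M / 2}) (𝓝[>] s)
      (𝓝 0) := by
  have hp0 : 0 < p := by linarith
  rw [MemContLp, add_sub_cancel_right] at hu
  have hs : s ∈ Icc s (s + h) := ⟨le_rfl, by linarith⟩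
  have h1 := (hu.2 s hs).mono_left (nhdsWithin_mono s Ioc_subset_Icc_self)
  rw [nhdsWithin_Ioc_eq_nhdsGT (by linarith)] at h1
  set m : ℝ≥0∞ := ENNReal.ofReal (M / 2) with hm
  have hm0 : m ≠ 0 := by rw [hm]; simpa using hM
  have hlim : Tendsto (fun t => m⁻¹ ^ p * eLpNorm (fun x => u (x, t) - u (x, s))
      (ENNReal.ofReal p) (volume.restrict (cube x₀ r)) ^ p) (𝓝[>] s) (𝓝 0) := by
    have h2 := (ENNReal.continuous_rpow_const (y := p)).tendsto 0 |>.comp h1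
    rw [ENNReal.zero_rpow_of_pos hp0] at h2
    have h3 := ENNReal.Tendsto.const_mul (a := m⁻¹ ^ p) h2
      (Or.inr (ENNReal.rpow_ne_top_of_nonneg hp0.le (ENNReal.inv_ne_top.2 hm0)))
    rwa [mul_zero] at h3
  refine tendsto_of_tendsto_of_tendsto_of_le_of_le' tendsto_const_nhds hlim
    (Eventually.of_forall fun _ => zero_le) ?_
  filter_upwards [Ioc_mem_nhdsGT (show s < s + h by linarith)] with t ht
  have htI : t ∈ Icc s (s + h) := Ioc_subset_Icc_self ht
  have hcheb := meas_ge_le_mul_pow_eLpNorm_enorm (volume.restrict (cube x₀ r))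
    (p := ENNReal.ofReal p) (by simpa using hp0) ENNReal.ofReal_ne_top
    ((hu.1 t htI).1.sub (hu.1 s hs).1) hm0 (fun h => absurd h ENNReal.ofReal_ne_top)
  rw [ENNReal.toReal_ofReal hp0.le, Measure.restrict_apply' (measurableSet_cube x₀ r)] at hcheb
  refine le_trans (measure_mono ?_) hcheb
  intro x hx
  refine ⟨?_, hx.1⟩
  have h2 : M < u (x, s) := hx.2.1
  have h3 : u (x, t) ≤ M / 2 := hx.2.2
  change m ≤ ‖u (x, t) - u (x, s)‖ₑ
  rw [← ofReal_norm, Real.norm_eq_abs]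
  refine ENNReal.ofReal_le_ofReal (le_abs.2 (Or.inr ?_))
  linarith

/-- The initial slice of the cube need not be contained in `E`. Exhausting the part of it in `E` by
finitely many small cubes and using `L^p` continuity on each of them, the measure information passes
to later times, arbitrarily close to the initial one, with a small loss. -/
lemma exists_initial_time (hp : 1 < p) (hE : IsOpen E) (hB : MemBMinus p γ E u)
    (hu : ∀ᵐ z ∂(volume.restrict E), 0 ≤ u z) {y : Space N} {s b ρ M α : ℝ} (hα : 0 < α)
    (hρ : 0 < ρ) (hM : 0 < M) (hsb : s < b) (hsub : cube y ρ ×ˢ Ioc s b ⊆ E)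
    (hmeas : ENNReal.ofReal α * volume (cube y ρ)
      ≤ volume {x ∈ cube y ρ | (x, s) ∈ E ∧ M < u (x, s)}) :
    ∃ a ∈ Ioo s b, NonnegSlice u (cube y ρ) a ∧
      ENNReal.ofReal (3 * α / 4) * volume (cube y ρ)
        ≤ volume {x ∈ cube y ρ | M / 2 < u (x, a)} := by
  set V := volume (cube y ρ) with hV
  have hV_top : V ≠ ∞ := volume_cube_ne_top y ρ
  have hV0 : V ≠ 0 := volume_cube_ne_zero y hρ
  set S := {x ∈ cube y ρ | (x, s) ∈ E ∧ M < u (x, s)} with hS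
  have hbox : ∀ x : Space N, (x, s) ∈ E →
      ∃ r h : ℝ, 0 < r ∧ 0 < h ∧ closedCube x r ×ˢ Icc s (s + h) ⊆ E := by
    intro x hx
    obtain ⟨U, hU, W, hW, hUW⟩ := mem_nhds_prod_iff.1 (hE.mem_nhds hx)
    obtain ⟨d, hd, hdU⟩ := Metric.nhds_basis_closedBall.mem_iff.1 hU
    obtain ⟨e, he, heW⟩ := Metric.nhds_basis_closedBall.mem_iff.1 hW
    refine ⟨d / (√N + 1), e, by positivity, he, (Set.prod_mono ?_ ?_).trans hUW⟩
    · refine (closedCube_subset_closedBall (by positivity)).trans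
        ((Metric.closedBall_subset_closedBall ?_).trans hdU)
      rw [mul_div_assoc', div_le_iff₀ (by positivity)]
      nlinarith
    · refine (fun t ht => heW ?_)
      rw [Metric.mem_closedBall, Real.dist_eq, abs_le]
      constructor <;> linarith [ht.1, ht.2]
  choose! r h hr hh hrh using hbox
  obtain ⟨T, hTsub, hTc, hTeq⟩ := TopologicalSpace.isOpen_biUnion_countable
    {x : Space N | (x, s) ∈ E} (fun x => cube x (r x)) fun x _ => isOpen_cube x (r x)
  have hcover : ∀ x ∈ S, ∃ x₀ ∈ T, x ∈ cube x₀ (r x₀) := by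
    intro x hx
    have : x ∈ ⋃ i ∈ T, cube i (r i) := by
      rw [hTeq]
      exact mem_biUnion (show x ∈ {x : Space N | (x, s) ∈ E} from hx.2.1)
        (fun i => by simpa using hr x hx.2.1)
    simpa using this
  have hαV : ENNReal.ofReal α * V ≠ 0 := mul_ne_zero (by simpa using hα) hV0
  have hTne : T.Nonempty := by
    by_contra hne
    rw [Set.not_nonempty_iff_eq_empty] at hne
    have : S = ∅ := Set.eq_empty_of_forall_notMem fun x hx => by
      obtain ⟨x₀, hx₀, -⟩ := hcover x hx
      simp [hne] at hx₀
    rw [this, measure_empty] at hmeas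
    exact hαV (le_antisymm hmeas zero_le)
  obtain ⟨f, rfl⟩ := hTc.exists_eq_range hTne
  have hfE : ∀ i, (f i, s) ∈ E := fun i => hTsub ⟨i, rfl⟩
  -- finitely many cubes see almost all of `S`
  obtain ⟨n, hn⟩ : ∃ n, ENNReal.ofReal (7 * α / 8) * V
      < volume (S ∩ ⋃ i ∈ Finset.range n, cube (f i) (r (f i))) := by
    have hmono : Monotone fun n : ℕ => S ∩ ⋃ i ∈ Finset.range n, cube (f i) (r (f i)) := by
      intro m n hmn
      refine inter_subset_inter_right _ (biUnion_mono ?_ fun _ _ => subset_rfl)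
      exact fun i hi => Finset.range_mono hmn hi
    have hU : ⋃ n : ℕ, (S ∩ ⋃ i ∈ Finset.range n, cube (f i) (r (f i))) = S := by
      refine subset_antisymm (iUnion_subset fun n => inter_subset_left) fun x hx => ?_
      obtain ⟨x₀, ⟨i, rfl⟩, hi⟩ := hcover x hx
      exact mem_iUnion.2 ⟨i + 1, hx, mem_biUnion (by simp) hi⟩
    rw [← lt_iSup_iff, ← hmono.measure_iUnion, hU]
    refine lt_of_lt_of_le ?_ hmeas
    exact (ENNReal.mul_lt_mul_iff_left hV0 hV_top).2
      ((ENNReal.ofReal_lt_ofReal_iff hα).2 (by linarith))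
  have hbad : Tendsto (fun t => ∑ i ∈ Finset.range n,
      volume {x ∈ cube (f i) (r (f i)) | M < u (x, s) ∧ u (x, t) ≤ M / 2}) (𝓝[>] s) (𝓝 0) := by
    have h0 : (0 : ℝ≥0∞) = ∑ _i ∈ Finset.range n, 0 := by simp
    rw [h0]
    refine tendsto_finsetSum _ fun i _ => ?_
    refine tendsto_volume_drop hp (hh _ (hfE i)) hM (hB.memContLp _ _ _ _ (hr _ (hfE i))
      (hh _ (hfE i)) (compactlyContained_cyl ?_))
    rw [add_sub_cancel_right]
    exact hrh _ (hfE i)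
  have hα8 : 0 < ENNReal.ofReal (α / 8) * V :=
    pos_iff_ne_zero.2 (mul_ne_zero (by simpa using hα) hV0)
  obtain ⟨c, hc, hcs⟩ := (mem_nhdsGT_iff_exists_Ioo_subset' hsb).1 (hbad.eventually_le_const hα8)
  have hc' : s < c := hc
  obtain ⟨a, ha, hnn⟩ := exists_mem_Ioo_of_ae (ae_nonnegSlice hu hsub) (lt_min hc' hsb)
    (Ioo_subset_Ioo_right (min_le_right _ _))
  refine ⟨a, ⟨ha.1, ha.2.trans_le (min_le_right _ _)⟩, hnn, ?_⟩
  have hsmall : ∑ i ∈ Finset.range n,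
      volume {x ∈ cube (f i) (r (f i)) | M < u (x, s) ∧ u (x, a) ≤ M / 2}
      ≤ ENNReal.ofReal (α / 8) * V := hcs ⟨ha.1, ha.2.trans_le (min_le_left _ _)⟩
  have hle : volume (S ∩ ⋃ i ∈ Finset.range n, cube (f i) (r (f i)))
      ≤ volume {x ∈ cube y ρ | M / 2 < u (x, a)} + ENNReal.ofReal (α / 8) * V := by
    refine le_trans ?_ (add_le_add le_rfl hsmall)
    refine le_trans ?_ (add_le_add le_rfl (measure_biUnion_finset_le _ _))
    refine (measure_mono fun x hx => ?_).trans (measure_union_le _ _)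
    rcases lt_or_ge (M / 2) (u (x, a)) with hlt | hge
    · exact Or.inl ⟨hx.1.1, hlt⟩
    · obtain ⟨i, hi, hxi⟩ := mem_iUnion₂.1 hx.2
      exact Or.inr (mem_biUnion hi ⟨hxi, hx.1.2.2, hge⟩)
  have hfin := hn.le.trans hle
  rw [show 7 * α / 8 = 3 * α / 4 + α / 8 by ring, ENNReal.ofReal_add (by positivity) (by positivity),
    add_mul] at hfin
  exact (ENNReal.add_le_add_iff_right (ENNReal.mul_ne_top ENNReal.ofReal_ne_top hV_top)).1 hfin

/-! ### Propagation of measure information for a long time -/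

/-- Iteration of the short-time step and of the restart: each round lowers the level by the factor
`η` and advances time by at least `δ ρ ^ p / 2`. -/
lemma volume_superlevel_ge_of_restart {α σ δ ε η : ℝ} (hp : 1 < p) (hγ : 0 < γ) (hα0 : 0 < α)
    (hc : ShortTimeParams N p γ α σ δ ε) (hη0 : 0 < η) (hη1 : η ≤ 1) (hB : MemBMinus p γ E u)
    (hu : ∀ᵐ z ∂(volume.restrict E), 0 ≤ u z) {y : Space N} {s b ρ : ℝ} (hρ : 0 < ρ)
    (hE : cube y ρ ×ˢ Ioc s b ⊆ E)
    (hrestart : ∀ a M : ℝ, 0 < M → cube y ρ ×ˢ Icc a (a + δ * ρ ^ p) ⊆ E →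
      NonnegSlice u (cube y ρ) a →
      ENNReal.ofReal (3 * α / 4) * volume (cube y ρ) ≤ volume {x ∈ cube y ρ | M < u (x, a)} →
      ∃ t ∈ Ioo (a + δ * ρ ^ p / 2) (a + δ * ρ ^ p), NonnegSlice u (cube y ρ) t ∧
        ENNReal.ofReal (3 * α / 4) * volume (cube y ρ)
          ≤ volume {x ∈ cube y ρ | η * M < u (x, t)})
    (m : ℕ) : ∀ a M : ℝ, s < a → 0 < M → NonnegSlice u (cube y ρ) a →
      ENNReal.ofReal (3 * α / 4) * volume (cube y ρ) ≤ volume {x ∈ cube y ρ | M < u (x, a)} →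
      ∀ t, a < t → t ≤ b → t - a ≤ (m + 1) * (δ * ρ ^ p / 2) →
      ENNReal.ofReal (α / 2) * volume (cube y ρ)
        ≤ volume {x ∈ cube y ρ | ε * η ^ m * M < u (x, t)} := by
  have hδ := hc.δ_pos
  have hε := hc.ε_pos
  have hρp : 0 < ρ ^ p := Real.rpow_pos_of_pos hρ p
  have hshort : ∀ (m : ℕ) (a M : ℝ), s < a → 0 < M → NonnegSlice u (cube y ρ) a →
      ENNReal.ofReal (3 * α / 4) * volume (cube y ρ) ≤ volume {x ∈ cube y ρ | M < u (x, a)} →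
      ∀ t, a < t → t ≤ b → t - a ≤ δ * ρ ^ p →
      ENNReal.ofReal (α / 2) * volume (cube y ρ)
        ≤ volume {x ∈ cube y ρ | ε * η ^ m * M < u (x, t)} := by
    intro m a M hsa hM ha hmeas t hat htb htδ
    refine (volume_superlevel_ge hp hγ hα0 hc hB hu hρ hM hat htδ
      ((Set.prod_mono_right (Icc_subset_Ioc hsa htb)).trans hE) ha
      hmeas).trans (measure_mono fun x hx => ⟨cube_mono ?_ hx.1, lt_of_le_of_lt ?_ hx.2⟩)
    · nlinarith [hc.σ_pos]
    · have : η ^ m ≤ 1 := pow_le_one₀ hη0.le hη1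
      have h2 : ε * η ^ m ≤ ε := mul_le_of_le_one_right hε.le this
      exact mul_le_mul_of_nonneg_right h2 hM.le
  induction m with
  | zero =>
    intro a M hsa hM ha hmeas t hat htb htm
    refine hshort 0 a M hsa hM ha hmeas t hat htb (htm.trans ?_)
    have : 0 < δ * ρ ^ p := by positivity
    push_cast; linarith
  | succ m ih =>
    intro a M hsa hM ha hmeas t hat htb htm
    rcases le_or_gt (t - a) (δ * ρ ^ p) with hle | hgt
    · exact hshort (m + 1) a M hsa hM ha hmeas t hat htb hle
    · obtain ⟨a', ha', hnn, hmeas'⟩ := hrestart a M hM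
        ((Set.prod_mono_right (Icc_subset_Ioc hsa (by linarith))).trans hE) ha hmeas
      have hpos : 0 < δ * ρ ^ p := by positivity
      have h := ih a' (η * M) (by linarith [ha'.1]) (by positivity) hnn hmeas' t
        (by linarith [ha'.2]) htb (by push_cast at htm; linarith [ha'.1])
      rwa [show ε * η ^ m * (η * M) = ε * η ^ (m + 1) * M by ring] at h

end ParabolicDeGiorgi

theorem proposition4p2 (N : ℕ) (hN : 1 ≤ N) (p : ℝ) (hp : 1 < p) (γ : ℝ) (hγ : 0 < γ)
    (α : ℝ) (hα0 : 0 < α) (hα1 : α < 1) (A : ℝ) (hA : 0 < A) :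
    ∃ ε : ℝ, 0 < ε ∧
      ∀ (E : Set (ParabolicDeGiorgi.SpaceTime N)), IsOpen E →
      ∀ u : ParabolicDeGiorgi.SpaceTime N → ℝ, ParabolicDeGiorgi.MemBMinus p γ E u →
        (∀ᵐ z ∂(volume.restrict E), 0 ≤ u z) →
      ∀ (y : ParabolicDeGiorgi.Space N) (s ρ M : ℝ), 0 < ρ → 0 < M →
        ParabolicDeGiorgi.cube y ρ ×ˢ Ioc s (s + A * ρ ^ p) ⊆ E →
        ENNReal.ofReal α * volume (ParabolicDeGiorgi.cube y ρ)
          ≤ volume {x ∈ ParabolicDeGiorgi.cube y ρ | (x, s) ∈ E ∧ M < u (x, s)} →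
        ∀ t : ℝ, s < t → t < s + A * ρ ^ p →
          ENNReal.ofReal (α / 2) * volume (ParabolicDeGiorgi.cube y ρ)
            ≤ volume {x ∈ ParabolicDeGiorgi.cube y ρ | ε * M < u (x, t)} := by
  obtain ⟨σ, δ, ε, hc⟩ := ParabolicDeGiorgi.exists_shortTimeParams N (p := p) hγ hα0
  obtain ⟨η, hη0, hη1, hrestart⟩ :=
    ParabolicDeGiorgi.exists_restart_level hp hγ hα0 hα1 hc
  have hδ := hc.δ_pos
  have hε := hc.ε_pos
  obtain ⟨m, hm⟩ := exists_nat_gt (A / (δ / 2))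
  refine ⟨ε * η ^ m / 2, by positivity, ?_⟩
  intro E hE u hB hu y s ρ M hρ hM hsub hmeas t hst htA
  have hρp : 0 < ρ ^ p := Real.rpow_pos_of_pos hρ p
  obtain ⟨a, ha, hnn, hmeas'⟩ := ParabolicDeGiorgi.exists_initial_time hp hE hB hu hα0 hρ hM hst
    ((Set.prod_mono_right (Ioc_subset_Ioc_right htA.le)).trans hsub) hmeas
  have h := ParabolicDeGiorgi.volume_superlevel_ge_of_restart hp hγ hα0 hc hη0 hη1 hB hu hρ hsub
    (fun a M hM hsub' hnn' hm' => hrestart E u hB hu y a ρ M hρ hM hsub' hnn' hm') m a (M / 2)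
    ha.1 (by positivity) hnn hmeas' t ha.2 htA.le (by
      rw [div_lt_iff₀ (by positivity)] at hm
      have h1 := mul_lt_mul_of_pos_right hm hρp
      have h2 : 0 < δ * ρ ^ p := by positivity
      linarith [ha.1])
  rwa [show ε * η ^ m * (M / 2) = ε * η ^ m / 2 * M by ring] at h
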